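/- Let $X$ be a weakly systolic complex, i.e. a connected (nonempty) flag simplicial complex such that for every vertex $v$, every integer $i\ge 0$ and every simplex $\sigma$ of $X$ all of whose vertices are at distance exactly $i+1$ from $v$, the vertices of the link of $\sigma$ in $X$ that are at distance at most $i$ from $v$ are the vertices of a nonempty simplex of $X$. Here distances are combinatorial distances $d_X$ between vertices in the $1$-skeleton of $X$. Assume that $X$ is uniformly locally finite, i.e. there is a constant $N$ such that every vertex of $X$ has at most $N$ neighbours. Let $h$ be a simplicial isometry of $X$, i.e. a bijection of the vertex set that maps simplices to simplices and preserves $d_X$. Then at least one of the following holds: 1. (elliptic case) there is a simplex $\sigma$ of $X$ with $h(\sigma)=\sigma$; 2. (hyperbolic case) there is an $h$-invariant thick geodesic in $X$: there are an integer $k\ge 1$ and an injective map $f$ from $\mathbb Z$ to the vertices of $X$ such that $h(f(\mathbb Z))=f(\mathbb Z)$, a finite nonempty set $\sigma\subset\mathbb Z$ has image $f(\sigma)$ spanning a simplex of $X$ if and only if $|a-a'|\le k$ for all $a,a'\in\sigma$, and $d_X(f(a),f(a'))=d_{A_k}(a,a')$ whenever $a-a'$ is a multiple of $k$. Here $A_k$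 is the simplicial complex with vertex set $\mathbb Z$ whose simplices are the nonempty finite sets $\sigma\subset\mathbb Z$ with $|a-a'|\le k$ for all $a,a'\in\sigma$. In particular, if $h$ leaves no simplex of $X$ invariant, then it leaves a thick geodesic invariant. -/

import Mathlib

namespace AbstractSimplicialComplex

variable {V : Type*}

open scoped Classical in
/-- The `1`-skeleton of a simplicial complex, as a simple graph on its vertices. -/
def skeletonGraph (X : AbstractSimplicialComplex V) : SimpleGraph V where
  Adj u v := u ≠ v ∧ ({u, v} : Finset V) ∈ X.faces
  symm := ⟨fun u v h => ⟨h.1.symm, Finset.pair_comm u v ▸ h.2⟩⟩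
  loopless := ⟨fun _ h => h.1 rfl⟩

/-- The combinatorial metric on the vertices: the number of edges of a shortest path in the
`1`-skeleton. (It is the true distance whenever the complex is connected.) -/
noncomputable def vdist (X : AbstractSimplicialComplex V) (u v : V) : ℕ :=
  X.skeletonGraph.dist u v

/-- A complex is flag if every nonempty finite set of vertices which are pairwise joined by edges
spans a simplex. -/
def IsFlag (X : AbstractSimplicialComplex V) : Prop :=
  ∀ s : Finset V, s.Nonempty → (∀ u ∈ s, ∀ v ∈ s, u ≠ v → X.skeletonGraph.Adj u v) → s ∈ X.faces

open scoped Classical in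
/-- The link of `X` at `σ`: all simplices of `X` which are disjoint from `σ` and which, together
with `σ`, span a simplex of `X`. -/
def link (X : AbstractSimplicialComplex V) (σ : Finset V) : PreAbstractSimplicialComplex V where
  faces := {τ | τ ∈ X.faces ∧ Disjoint τ σ ∧ τ ∪ σ ∈ X.faces}
  isRelLowerSet_faces := fun _ h =>
    ⟨(X.isRelLowerSet_faces h.1).1, fun _ hρτ hρ =>
      ⟨(X.isRelLowerSet_faces h.1).2 hρτ hρ, h.2.1.mono_left hρτ,
        (X.isRelLowerSet_faces h.2.2).2 (Finset.union_subset_union_left hρτ)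
          (hρ.mono Finset.subset_union_left)⟩⟩

/-- The property `SD_n(v)`: for each `i ≤ n` and each simplex `σ` whose vertices lie in the sphere
`S_{i+1}(v)`, the vertices of the link of `X` at `σ` lying in the ball `B_i(v)` form the vertex set
of a (nonempty) simplex of `X`. -/
def HasSD (X : AbstractSimplicialComplex V) (n : ℕ) (v : V) : Prop :=
  ∀ i ≤ n, ∀ σ ∈ X.faces, (∀ w ∈ σ, X.vdist v w = i + 1) →
    ∃ τ ∈ X.faces, (τ : Set V) = {w | {w} ∈ (X.link σ).faces ∧ X.vdist v w ≤ i}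

/-- A weakly systolic complex: a connected (in particular nonempty) flag complex with the
properties `SD_n(v)` for all vertices `v` and all natural numbers `n`. -/
structure IsWeaklySystolic (X : AbstractSimplicialComplex V) : Prop where
  connected : X.skeletonGraph.Connected
  flag : X.IsFlag
  sd : ∀ (v : V) (n : ℕ), X.HasSD n v

/-- Uniform local finiteness: the number of neighbours of a vertex is bounded by a constant. -/
def IsUniformlyLocallyFinite (X : AbstractSimplicialComplex V) : Prop :=
  ∃ N : ℕ, ∀ v : V, (X.skeletonGraph.neighborSet v).encard ≤ N

/-- A bijection of the vertex set is a simplicial isometry if it maps simplices to simplices and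
preserves the combinatorial metric. -/
structure IsSimplicialIsometry (X : AbstractSimplicialComplex V) (h : V ≃ V) : Prop where
  map_mem : ∀ σ ∈ X.faces, σ.map h.toEmbedding ∈ X.faces
  vdist_map : ∀ u v : V, X.vdist (h u) (h v) = X.vdist u v

/-- The complex `A_k` with vertex set `ℤ`, in which a nonempty finite set is a simplex if and only
if any two of its elements differ by at most `k`. -/
def thickLine (k : ℕ) : AbstractSimplicialComplex ℤ where
  faces := {σ | σ.Nonempty ∧ ∀ a ∈ σ, ∀ b ∈ σ, |a - b| ≤ (k : ℤ)}
  isRelLowerSet_faces := fun _ h => ⟨h.1, fun _ hts ht =>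
    ⟨ht, fun a ha b hb => h.2 a (hts ha) b (hts hb)⟩⟩
  singleton_mem := fun v => ⟨Finset.singleton_nonempty v, fun a ha b hb => by
    rw [Finset.mem_singleton.1 ha, Finset.mem_singleton.1 hb, sub_self, abs_zero]
    exact Int.natCast_nonneg k⟩

/-- The injection `f` of the vertices of `A_k` into those of `X`, `k ≥ 1`, is (a parametrization
of) a thick geodesic: it identifies `A_k` with the full subcomplex of `X` spanned by the image of
`f`, and `d_X(f a, f a') = d_{A_k}(a, a')` whenever `a - a'` is a multiple of `k`. -/
structure IsThickGeodesic (X : AbstractSimplicialComplex V) (k : ℕ) (f : ℤ ↪ V) : Prop where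
  one_le : 1 ≤ k
  full : ∀ σ : Finset ℤ, σ.map f ∈ X.faces ↔ σ ∈ (thickLine k).faces
  vdist_eq : ∀ a a' j : ℤ, a - a' = j * k → X.vdist (f a) (f a') = (thickLine k).vdist a a'

end AbstractSimplicialComplex

/-- The combinatorial metrics of weakly systolic complexes, described without reference to the
complex: balls are simply descending. Two points are regarded as adjacent if their distance is
at most `1`. -/
structure IsSDMetric {V : Type*} (d : V → V → ℕ) : Prop where
  self_iff : ∀ {u v : V}, d u v = 0 ↔ u = v
  symm : ∀ u v : V, d u v = d v u
  tri : ∀ u v w : V, d u w ≤ d u v + d v w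
  exists_common : ∀ (v : V) (i : ℕ) (σ : Finset V), σ.Nonempty → (∀ x ∈ σ, d v x = i + 1) →
    (∀ x ∈ σ, ∀ y ∈ σ, d x y ≤ 1) → ∃ y, d v y ≤ i ∧ ∀ x ∈ σ, d x y ≤ 1
  descend_clique : ∀ (v : V) (i : ℕ) (x y z : V), d v x = i + 1 → d v y ≤ i → d v z ≤ i →
    d x y ≤ 1 → d x z ≤ 1 → d y z ≤ 1

namespace IsSDMetric

variable {V : Type*} {d : V → V → ℕ}

theorem self_eq (hd : IsSDMetric d) (u : V) : d u u = 0 := hd.self_iff.2 rfl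

theorem exists_step (hd : IsSDMetric d) {v x : V} {i : ℕ} (h : d v x = i + 1) :
    ∃ y, d v y = i ∧ d x y ≤ 1 := by
  obtain ⟨y, h1, h2⟩ := hd.exists_common v i {x} (Finset.singleton_nonempty x)
    (by simpa using h) (by simp [hd.self_eq])
  have h3 := h2 x (Finset.mem_singleton_self x)
  have h4 := hd.tri v y x
  rw [hd.symm y x] at h4
  exact ⟨y, by omega, h3⟩

theorem exists_common_pair (hd : IsSDMetric d) {v x y : V} {i : ℕ} (hx : d v x = i + 1)
    (hy : d v y = i + 1) (hxy : d x y ≤ 1) : ∃ z, d v z ≤ i ∧ d x z ≤ 1 ∧ d y z ≤ 1 := by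
  classical
  obtain ⟨z, h1, h2⟩ := hd.exists_common v i {x, y} (by simp)
    (by simp [hx, hy]) (by simp [hd.self_eq, hxy, hd.symm y x])
  exact ⟨z, h1, h2 x (by simp), h2 y (by simp)⟩

/-- A closed path of length four has a diagonal. -/
theorem diagonal (hd : IsSDMetric d) {a b c e : V} (hab : d a b ≤ 1) (hbc : d b c ≤ 1)
    (hce : d c e ≤ 1) (hea : d e a ≤ 1) : d a c ≤ 1 ∨ d b e ≤ 1 := by
  by_cases h : d a c ≤ 1
  · exact Or.inl h
  · have h1 := hd.tri a b c
    exact Or.inr (hd.descend_clique a 1 c b e (by omega) hab (by rw [hd.symm]; exact hea)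
      (by rw [hd.symm]; exact hbc) hce)

/-- Balls are convex. -/
theorem ball_convex (hd : IsSDMetric d) (v : V) : ∀ (k : ℕ) (w u t : V), d w t = k →
    d w u = k + 1 → d t u ≤ 1 → d v t ≤ max (d v w) (d v u) := by
  intro k
  induction k with
  | zero =>
    intro w u t h1 _ _
    rw [hd.self_iff] at h1
    subst h1
    exact le_max_left _ _
  | succ k ih =>
    intro w u t h1 h2 h3
    by_contra hlt
    obtain ⟨t1, h4, h5⟩ := hd.exists_step h1
    have e1 := hd.tri v u t
    rw [hd.symm u t] at e1
    have e2 := ih w t t1 h4 h1 (by rw [hd.symm]; exact h5)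
    have e3 := hd.tri w t1 u
    have e4 : d v t = d v u + 1 := by omega
    have e5 : d v t1 = d v u + 1 := by
      by_contra hne
      have := hd.descend_clique v (d v u) t u t1 e4 le_rfl (by omega) h3 h5
      rw [hd.symm] at this
      omega
    obtain ⟨y, h6, h7, h8⟩ := hd.exists_common_pair e4 e5 h5
    have e6 := hd.descend_clique v (d v u) t u y e4 le_rfl h6 h3 h7
    have e7 := hd.tri w t1 y
    have e8 := hd.tri w y u
    rw [hd.symm y u] at e8
    have := ih w y t1 h4 (by omega) h8
    omega

end IsSDMetric

/-- A set is convex for a graph metric if it contains all geodesics between its points. -/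
def MetricConvex {V : Type*} (d : V → V → ℕ) (C : Set V) : Prop :=
  ∀ w ∈ C, ∀ u ∈ C, ∀ t, d w t + 1 = d w u → d t u ≤ 1 → t ∈ C

/-- A set is descending if descents towards a point of the set, of a clique which meets the set,
can be made inside the set. -/
def IsDescending {V : Type*} (d : V → V → ℕ) (Y : Set V) : Prop :=
  ∀ w ∈ Y, ∀ (i : ℕ) (τ : Finset V), (∀ x ∈ τ, d w x = i + 1) → (∀ x ∈ τ, ∀ y ∈ τ, d x y ≤ 1) →
    ∀ u ∈ τ, u ∈ Y → ∃ y ∈ Y, d w y ≤ i ∧ ∀ x ∈ τ, d x y ≤ 1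

/-- The closed `1`-neighbourhood of a set. -/
def thickening {V : Type*} (d : V → V → ℕ) (Y : Set V) : Set V := {u | ∃ p ∈ Y, d u p ≤ 1}

namespace IsSDMetric

variable {V : Type*} {d : V → V → ℕ}

theorem metricConvex_ball (hd : IsSDMetric d) (v : V) (r : ℕ) :
    MetricConvex d {x | d v x ≤ r} := by
  intro w hw u hu t h1 h2
  have := hd.ball_convex v (d w t) w u t rfl h1.symm h2
  simp only [Set.mem_ofPred_eq] at *
  omega

theorem metricConvex_commonNeighbors (hd : IsSDMetric d) (s : Set V) :
    MetricConvex d {x | ∀ v ∈ s, d v x ≤ 1} := fun w hw u hu t h1 h2 v hv =>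
  hd.metricConvex_ball v 1 w (hw v hv) u (hu v hv) t h1 h2

theorem isDescending_univ (hd : IsSDMetric d) : IsDescending d Set.univ := by
  intro w _ i τ h1 h2 u hu _
  obtain ⟨y, h3, h4⟩ := hd.exists_common w i τ ⟨u, hu⟩ h1 h2
  exact ⟨y, trivial, h3, h4⟩

theorem isDescending_inter (hd : IsSDMetric d) {Y C : Set V} (hY : IsDescending d Y)
    (hC : MetricConvex d C) : IsDescending d (Y ∩ C) := by
  intro w hw i τ h1 h2 u hu huY
  obtain ⟨y, h3, h4, h5⟩ := hY w hw.1 i τ h1 h2 u hu huY.1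
  have e1 := h5 u hu
  have e2 := h1 u hu
  have e3 := hd.tri w y u
  rw [hd.symm y u] at e3
  exact ⟨y, ⟨h3, hC w hw.2 u huY.2 y (by omega) (by rw [hd.symm]; exact e1)⟩, h4, h5⟩

theorem isDescending_of_metricConvex (hd : IsSDMetric d) {C : Set V} (hC : MetricConvex d C) :
    IsDescending d C := by
  simpa using hd.isDescending_inter hd.isDescending_univ hC

theorem _root_.IsDescending.exists_step {Y : Set V} (hY : IsDescending d Y) (hd : IsSDMetric d)
    {w u : V} {i : ℕ} (hw : w ∈ Y) (hu : u ∈ Y) (h : d w u = i + 1) :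
    ∃ y ∈ Y, d w y ≤ i ∧ d u y ≤ 1 := by
  obtain ⟨y, h1, h2, h3⟩ := hY w hw i {u} (by simpa using h) (by simp [hd.self_eq]) u
    (by simp) hu
  exact ⟨y, h1, h2, h3 u (by simp)⟩

theorem _root_.IsDescending.exists_step_pair {Y : Set V} (hY : IsDescending d Y)
    (hd : IsSDMetric d) {w u x : V} {i : ℕ} (hw : w ∈ Y) (hu : u ∈ Y) (h : d w u = i + 1)
    (hx : d w x = i + 1) (hux : d u x ≤ 1) :
    ∃ y ∈ Y, d w y ≤ i ∧ d u y ≤ 1 ∧ d x y ≤ 1 := by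
  classical
  obtain ⟨y, h1, h2, h3⟩ := hY w hw i {u, x} (by simp [h, hx])
    (by simp [hd.self_eq, hux, hd.symm x u]) u (by simp) hu
  exact ⟨y, h1, h2, h3 u (by simp), h3 x (by simp)⟩

/-- Descending a point `q` of the set towards a point `p` of the set, together with an
adjacent point which is not farther away from `p`. -/
theorem _root_.IsDescending.exists_step_of_le {Y : Set V} (hY : IsDescending d Y)
    (hd : IsSDMetric d) {p q w : V} {l : ℕ} (hp : p ∈ Y) (hq : q ∈ Y) (hpq : d p q = l + 1)
    (hpw : d p w ≤ l + 1) (hwq : d w q ≤ 1) : ∃ y ∈ Y, d p y ≤ l ∧ d w y ≤ 1 := by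
  rcases Nat.lt_or_ge (d p w) (l + 1) with h | h
  · obtain ⟨y, h1, h2, h3⟩ := hY.exists_step hd hp hq hpq
    exact ⟨y, h1, h2, hd.descend_clique p l q w y hpq (by omega) h2
      (by rw [hd.symm q w]; exact hwq) h3⟩
  · obtain ⟨y, h1, h2, _, h4⟩ := hY.exists_step_pair hd (x := w) hp hq hpq (by omega)
      (by rw [hd.symm q w]; exact hwq)
    exact ⟨y, h1, h2, h4⟩

/-- A finite clique in the neighbourhood of a descending set has a common neighbour in the
set. -/
theorem exists_common_of_subset_thickening (hd : IsSDMetric d) {Y : Set V}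
    (hY : IsDescending d Y) (hne : Y.Nonempty) (σ : Finset V)
    (hσ : ∀ x ∈ σ, ∀ y ∈ σ, d x y ≤ 1) (hσY : ∀ x ∈ σ, x ∈ thickening d Y) :
    ∃ y ∈ Y, ∀ x ∈ σ, d x y ≤ 1 := by
  classical
  induction σ using Finset.induction_on with
  | empty => exact ⟨hne.some, hne.some_mem, by simp⟩
  | insert x σ hx ih =>
    obtain ⟨y1, hy1, h1⟩ := ih (fun a ha b hb => hσ a (by simp [ha]) b (by simp [hb]))
      (fun a ha => hσY a (by simp [ha]))
    obtain ⟨y2, hy2, h2⟩ := hσY x (by simp)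
    have key : ∀ (k : ℕ) (y1 : V), y1 ∈ Y → (∀ a ∈ σ, d a y1 ≤ 1) → d y2 y1 = k →
        ∃ y ∈ Y, ∀ a ∈ insert x σ, d a y ≤ 1 := by
      intro k
      induction k using Nat.strong_induction_on with
      | _ k ihk =>
      intro y1 hy1 h1 hk
      have hax : ∀ a ∈ σ, d a x ≤ 1 := fun a ha => hσ a (by simp [ha]) x (by simp)
      rcases Nat.lt_or_ge k 2 with hk2 | hk2
      · by_cases hxy : d x y1 ≤ 1
        · exact ⟨y1, hy1, fun a ha => by
            rcases Finset.mem_insert.1 ha with rfl | ha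
            · exact hxy
            · exact h1 a ha⟩
        · refine ⟨y2, hy2, fun a ha => ?_⟩
          rcases Finset.mem_insert.1 ha with rfl | ha
          · exact h2
          · rcases hd.diagonal (hax a ha) h2 (by omega : d y2 y1 ≤ 1)
              (by rw [hd.symm]; exact h1 a ha) with h | h
            · exact h
            · exact absurd h hxy
      · obtain ⟨i, rfl⟩ : ∃ i, k = i + 1 := ⟨k - 1, by omega⟩
        have hle : ∀ a ∈ σ, d y2 a ≤ i + 1 := fun a ha => by
          have e1 := hd.tri y2 x a
          have e2 := hax a ha
          rw [hd.symm y2 x, hd.symm x a] at e1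
          omega
        obtain ⟨y, hy, h3, h4⟩ := hY y2 hy2 i (insert y1 (σ.filter fun a => d y2 a = i + 1))
          (by
            intro z hz
            rcases Finset.mem_insert.1 hz with rfl | hz
            · exact hk
            · exact (Finset.mem_filter.1 hz).2)
          (by
            intro z hz z' hz'
            rcases Finset.mem_insert.1 hz with e | hz <;>
              rcases Finset.mem_insert.1 hz' with e' | hz'
            · simp [e, e', hd.self_eq]
            · rw [e, hd.symm]; exact h1 _ (Finset.mem_filter.1 hz').1
            · rw [e']; exact h1 _ (Finset.mem_filter.1 hz).1
            · exact hσ _ (by simp [(Finset.mem_filter.1 hz).1]) _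
                (by simp [(Finset.mem_filter.1 hz').1]))
          y1 (by simp) hy1
        have h5 := h4 y1 (by simp)
        refine ihk (d y2 y) (by omega) y hy (fun a ha => ?_) rfl
        rcases Nat.lt_or_ge (d y2 a) (i + 1) with h | h
        · exact hd.descend_clique y2 i y1 a y hk (by omega) h3
            (by rw [hd.symm]; exact h1 a ha) h5
        · exact h4 a (by simp [ha, le_antisymm (hle a ha) h])
    exact key _ y1 hy1 h1 rfl

/-- Two finite cliques with mutual distances at most `2` have a common neighbour. -/
theorem exists_common_of_le_two (hd : IsSDMetric d) (β τ : Finset V) (hτne : τ.Nonempty)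
    (hβ : ∀ x ∈ β, ∀ y ∈ β, d x y ≤ 1) (hτ : ∀ x ∈ τ, ∀ y ∈ τ, d x y ≤ 1)
    (h : ∀ b ∈ β, ∀ x ∈ τ, d b x ≤ 2) : ∃ c, (∀ b ∈ β, d b c ≤ 1) ∧ ∀ x ∈ τ, d x c ≤ 1 := by
  have h1 : ∀ x ∈ τ, ∃ c, d x c ≤ 1 ∧ ∀ b ∈ β, d b c ≤ 1 := by
    intro x hx
    obtain ⟨c, h2, h3⟩ := hd.exists_common_of_subset_thickening
      (hd.isDescending_of_metricConvex (hd.metricConvex_ball x 1))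
      ⟨x, by simp [hd.self_eq]⟩ β hβ (fun b hb => by
        have h4 := h b hb x hx
        rcases Nat.lt_or_ge (d b x) 2 with h5 | h5
        · exact ⟨x, by simp [hd.self_eq], by omega⟩
        · obtain ⟨y, h6, h7⟩ := hd.exists_step (v := x) (x := b) (i := 1)
            (by rw [hd.symm]; omega)
          exact ⟨y, by simp [h6], h7⟩)
    exact ⟨c, h2, h3⟩
  obtain ⟨x0, hx0⟩ := hτne
  obtain ⟨c0, _, hc0⟩ := h1 x0 hx0
  obtain ⟨c, h2, h3⟩ := hd.exists_common_of_subset_thickening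
    (hd.isDescending_of_metricConvex (hd.metricConvex_commonNeighbors (β : Set V)))
    ⟨c0, by simpa using hc0⟩ τ hτ (fun x hx => by
      obtain ⟨c, h2, h3⟩ := h1 x hx
      exact ⟨c, by simpa using h3, h2⟩)
  exact ⟨c, by simpa using h2, h3⟩

/-- A point adjacent to a descending set has a neighbour in the set one step closer to a given
point of the set. -/
theorem exists_neighbor_closer (hd : IsSDMetric d) {Y : Set V} (hY : IsDescending d Y)
    {u q : V} {j : ℕ} (hu : u ∈ thickening d Y) (hq : q ∈ Y) (hqu : d q u = j + 1) :
    ∃ p ∈ Y, d u p ≤ 1 ∧ d q p ≤ j := by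
  obtain ⟨p, hp, h1⟩ := hu
  have key : ∀ (l : ℕ) (p : V), p ∈ Y → d u p ≤ 1 → d q p = l →
      ∃ p ∈ Y, d u p ≤ 1 ∧ d q p ≤ j := by
    intro l
    induction l using Nat.strong_induction_on with
    | _ l ih =>
    intro p hp h1 h2
    rcases Nat.lt_or_ge j l with hl | hl
    · obtain ⟨l, rfl⟩ : ∃ i, l = i + 1 := ⟨l - 1, by omega⟩
      obtain ⟨y, hy, h3, h4⟩ := hY.exists_step_of_le hd hq hp h2 (by omega) h1
      exact ih (d q y) (by omega) y hy h4 rfl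
    · exact ⟨p, hp, h1, by omega⟩
  exact key _ p hp h1 rfl

/-- Two points adjacent to a descending set: the first has a neighbour in the set which is not
farther away from the second. -/
theorem exists_neighbor_not_farther (hd : IsSDMetric d) {Y : Set V} (hY : IsDescending d Y)
    {w u : V} (hw : w ∈ thickening d Y) (hu : u ∈ thickening d Y) :
    ∃ q ∈ Y, d w q ≤ 1 ∧ d q u ≤ max 1 (d w u) := by
  obtain ⟨q0, hq0, h1⟩ := hw
  obtain ⟨p0, hp0, h2⟩ := hu
  have key : ∀ (l : ℕ) (q p : V), q ∈ Y → p ∈ Y → d w q ≤ 1 → d u p ≤ 1 → d q p = l →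
      ∃ q ∈ Y, d w q ≤ 1 ∧ d q u ≤ max 1 (d w u) := by
    intro l
    induction l using Nat.strong_induction_on with
    | _ l ih =>
    intro q p hq hp h1 h2 hl
    have ht := hd.tri q p u
    rw [hd.symm p u] at ht
    rcases l with _ | l
    · exact ⟨q, hq, h1, by omega⟩
    · by_cases hwu : l + 2 ≤ d w u
      · exact ⟨q, hq, h1, by omega⟩
      · rcases Nat.lt_or_ge (d p w) (l + 2) with h3 | h3
        · obtain ⟨y, hy, h4, h5⟩ := hY.exists_step_of_le hd hp hq
            (by rw [hd.symm]; exact hl) (by omega) h1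
          exact ih (d y p) (by rw [hd.symm]; omega) y p hy hp h5 h2 rfl
        · have h4 := hd.tri p q w
          rw [hd.symm p q, hd.symm q w] at h4
          obtain ⟨y, hy, h5, h6⟩ := hY.exists_step hd hq hp hl
          have h7 := hd.tri w q y
          have h8 := hd.descend_clique w (l + 1) p u y (by rw [hd.symm]; omega) (by omega)
            (by omega) (by rw [hd.symm]; exact h2) h6
          exact ih (d q y) (by omega) q y hq hy h1 h8 rfl
  exact key _ q0 p0 hq0 hp0 h1 h2 rfl

end IsSDMetric

namespace IsSDMetric

variable {V : Type*} {d : V → V → ℕ}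

/-- The intersection of the `1`-neighbourhoods of the first `n` sets of a sequence. -/
def _root_.thickeningInter (d : V → V → ℕ) (Y : ℕ → Set V) (n : ℕ) : Set V :=
  {u | ∀ j < n, u ∈ thickening d (Y j)}

variable {Y : ℕ → Set V} {n : ℕ}

theorem exists_window (hd : IsSDMetric d) (hY : ∀ j < n, IsDescending d (Y j))
    (hYY : ∀ i j, i < j → j < n → Y i ⊆ thickening d (Y j)) {w u : V} {i : ℕ}
    (hw : w ∈ thickeningInter d Y n) (hu : u ∈ thickeningInter d Y n) (hwu : d w u = i + 1) :
    ∃ q : ℕ → V, ∀ j < n, q j ∈ Y j ∧ d w (q j) ≤ 1 ∧ d (q j) u ≤ i + 1 ∧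
      ∀ k < n, d (q j) (q k) ≤ 1 := by
  classical
  have key : ∀ m ≤ n, ∃ q : ℕ → V, ∀ j < m, q j ∈ Y j ∧ d w (q j) ≤ 1 ∧ d (q j) u ≤ i + 1 ∧
      ∀ k < m, d (q j) (q k) ≤ 1 := by
    intro m
    induction m with
    | zero => exact fun _ => ⟨fun _ => w, fun j hj => absurd hj (Nat.not_lt_zero j)⟩
    | succ m ih =>
      intro hm
      obtain ⟨q, hq⟩ := ih (by omega)
      have hY' : IsDescending d (Y m ∩ {x | d u x ≤ i + 1}) :=
        hd.isDescending_inter (hY m (by omega)) (hd.metricConvex_ball u (i + 1))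
      have hN : ∀ x ∈ insert w ((Finset.range m).image q), d x u ≤ i + 1 →
          x ∈ thickening d (Y m) → x ∈ thickening d (Y m ∩ {x | d u x ≤ i + 1}) := by
        intro x _ hx hxt
        obtain ⟨q', h1, h2, h3⟩ := hd.exists_neighbor_not_farther (hY m (by omega)) hxt
          (hu m (by omega))
        refine ⟨q', ⟨h1, ?_⟩, h2⟩
        change d u q' ≤ i + 1
        rw [hd.symm]
        omega
      have hw' := hN w (by simp) hwu.le (hw m (by omega))
      obtain ⟨y, hy, hy2⟩ := hd.exists_common_of_subset_thickening hY'
        (by obtain ⟨p, hp, _⟩ := hw'; exact ⟨p, hp⟩) (insert w ((Finset.range m).image q))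
        (by
          intro x hx z hz
          simp only [Finset.mem_insert, Finset.mem_image, Finset.mem_range] at hx hz
          rcases hx with rfl | ⟨a, ha, rfl⟩ <;> rcases hz with rfl | ⟨b, hb, rfl⟩
          · simp [hd.self_eq]
          · exact (hq b hb).2.1
          · rw [hd.symm]; exact (hq a ha).2.1
          · exact (hq a ha).2.2.2 b hb)
        (by
          intro x hx
          rcases Finset.mem_insert.1 hx with e | hx'
          · rw [e]; exact hw'
          · obtain ⟨a, ha, rfl⟩ := Finset.mem_image.1 hx'
            have ha := Finset.mem_range.1 ha
            exact hN _ hx (hq a ha).2.2.1 (hYY a m ha (by omega) (hq a ha).1))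
      have hqy : ∀ j < m, d (q j) y ≤ 1 := fun j hj =>
        hy2 _ (by simp only [Finset.mem_insert, Finset.mem_image, Finset.mem_range]
                  exact Or.inr ⟨j, hj, rfl⟩)
      refine ⟨Function.update q m y, fun j hj => ?_⟩
      rcases Nat.lt_succ_iff_lt_or_eq.1 hj with hj | rfl
      · rw [Function.update_of_ne hj.ne]
        refine ⟨(hq j hj).1, (hq j hj).2.1, (hq j hj).2.2.1, fun k hk => ?_⟩
        rcases Nat.lt_succ_iff_lt_or_eq.1 hk with hk | rfl
        · rw [Function.update_of_ne hk.ne]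
          exact (hq j hj).2.2.2 k hk
        · rw [Function.update_self]
          exact hqy j hj
      · rw [Function.update_self]
        refine ⟨hy.1, hy2 w (by simp), by rw [hd.symm]; exact hy.2, fun k hk => ?_⟩
        rcases Nat.lt_succ_iff_lt_or_eq.1 hk with hk | rfl
        · rw [Function.update_of_ne hk.ne, hd.symm]
          exact hqy k hk
        · rw [Function.update_self, hd.self_eq]
          exact Nat.zero_le _
  exact key n le_rfl

theorem thickeningInter_exists_step (hd : IsSDMetric d) (hY : ∀ j < n, IsDescending d (Y j))
    (hYY : ∀ i j, i < j → j < n → Y i ⊆ thickening d (Y j)) {w u : V} {i : ℕ}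
    (hw : w ∈ thickeningInter d Y n) (hu : u ∈ thickeningInter d Y n) (hwu : d w u = i + 1) :
    ∃ r ∈ thickeningInter d Y n, d w r ≤ i ∧ d u r ≤ 1 := by
  classical
  rcases i with _ | i
  · exact ⟨w, hw, by simp [hd.self_eq], by rw [hd.symm]; omega⟩
  obtain ⟨q, hq⟩ := hd.exists_window hY hYY hw hu hwu
  obtain ⟨c, hc, hc2⟩ := hd.exists_common u (i + 1)
    (insert w (((Finset.range n).image q).filter fun x => d x u = i + 2)) (by simp)
    (by
      intro x hx
      rcases Finset.mem_insert.1 hx with e | hx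
      · rw [e, hd.symm]; exact hwu
      · rw [hd.symm]; exact (Finset.mem_filter.1 hx).2)
    (by
      intro x hx z hz
      simp only [Finset.mem_insert, Finset.mem_filter, Finset.mem_image, Finset.mem_range]
        at hx hz
      rcases hx with rfl | ⟨⟨a, ha, rfl⟩, _⟩ <;> rcases hz with rfl | ⟨⟨b, hb, rfl⟩, _⟩
      · simp [hd.self_eq]
      · exact (hq b hb).2.1
      · rw [hd.symm]; exact (hq a ha).2.1
      · exact (hq a ha).2.2.2 b hb)
  have hwc := hc2 w (by simp)
  have e1 := hd.tri w c u
  rw [hd.symm c u] at e1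
  obtain ⟨r, hr, hur⟩ := hd.exists_step (v := c) (x := u) (i := i) (by rw [hd.symm]; omega)
  have hwr : d w r ≤ i + 1 := by
    have := hd.tri w c r
    omega
  refine ⟨r, fun j hj => ?_, hwr, hur⟩
  obtain ⟨h1, h2, h3, _⟩ := hq j hj
  rcases h3.lt_or_eq with h4 | h4
  · have e2 := hd.tri w (q j) u
    obtain ⟨p, hp, h5, h6⟩ := hd.exists_neighbor_closer (hY j hj) (hu j hj) h1
      (j := i) (by omega)
    have e3 := hd.tri w (q j) p
    exact ⟨p, hp, hd.descend_clique w (i + 1) u r p hwu hwr (by omega) hur h5⟩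
  · obtain ⟨p, hp, h5, h6⟩ := hd.exists_neighbor_closer (hY j hj) (hu j hj) h1 h4
    have e2 := hc2 (q j) (by
      simp only [Finset.mem_insert, Finset.mem_filter, Finset.mem_image, Finset.mem_range]
      exact Or.inr ⟨⟨j, hj, rfl⟩, h4⟩)
    have e3 := hd.tri (q j) c r
    exact ⟨p, hp, hd.descend_clique (q j) (i + 1) u r p h4 (by omega) h6 hur h5⟩

theorem thickeningInter_descend_two (hd : IsSDMetric d) (hY : ∀ j < n, IsDescending d (Y j))
    (hYY : ∀ i j, i < j → j < n → Y i ⊆ thickening d (Y j)) {w u : V} {τ : Finset V}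
    (hw : w ∈ thickeningInter d Y n) (hu : u ∈ thickeningInter d Y n)
    (hτ : ∀ x ∈ τ, d w x = 2) (hττ : ∀ x ∈ τ, ∀ y ∈ τ, d x y ≤ 1) (huτ : u ∈ τ) :
    ∃ y ∈ thickeningInter d Y n, d w y ≤ 1 ∧ ∀ x ∈ τ, d x y ≤ 1 := by
  classical
  have hwu := hτ u huτ
  obtain ⟨q, hq⟩ := hd.exists_window hY hYY hw hu hwu
  let easy : ℕ → Prop := fun j => ∃ p ∈ Y j, d u p ≤ 1 ∧ d w p ≤ 1
  have hard : ∀ j < n, ¬ easy j → d (q j) u = 2 ∧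
      ∃ p ∈ Y j, d u p ≤ 1 ∧ d (q j) p ≤ 1 := by
    intro j hj hne
    obtain ⟨h1, h2, h3, _⟩ := hq j hj
    have h4 : d (q j) u = 2 := by
      by_contra h
      exact hne ⟨q j, h1, by rw [hd.symm]; omega, h2⟩
    exact ⟨h4, hd.exists_neighbor_closer (hY j hj) (hu j hj) h1 h4⟩
  obtain ⟨c, hc1, hc2⟩ := hd.exists_common_of_le_two
    (insert w (((Finset.range n).filter fun j => ¬ easy j).image q)) τ ⟨u, huτ⟩
    (by
      intro x hx z hz
      simp only [Finset.mem_insert, Finset.mem_filter, Finset.mem_image, Finset.mem_range]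
        at hx hz
      rcases hx with rfl | ⟨a, ⟨ha, _⟩, rfl⟩ <;> rcases hz with rfl | ⟨b, ⟨hb, _⟩, rfl⟩
      · simp [hd.self_eq]
      · exact (hq b hb).2.1
      · rw [hd.symm]; exact (hq a ha).2.1
      · exact (hq a ha).2.2.2 b hb)
    hττ
    (by
      intro b hb x hx
      simp only [Finset.mem_insert, Finset.mem_filter, Finset.mem_image, Finset.mem_range]
        at hb
      rcases hb with rfl | ⟨j, ⟨hj, hne⟩, rfl⟩
      · exact (hτ x hx).le
      · by_contra hlt
        obtain ⟨_, p, hp, h5, h6⟩ := hard j hj hne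
        have h2 := (hq j hj).2.1
        rw [hd.symm] at h2
        have e1 := hd.tri (q j) w x
        have e2 := hd.tri x u p
        have e3 := hττ x hx u huτ
        have e4 := hτ x hx
        exact hne ⟨p, hp, h5, hd.descend_clique x 2 (q j) w p (by rw [hd.symm]; omega)
          (by rw [hd.symm]; omega) (by omega) h2 h6⟩)
  have hwc := hc1 w (by simp)
  refine ⟨c, fun j hj => ?_, hwc, hc2⟩
  by_cases he : easy j
  · obtain ⟨p, hp, h1, h2⟩ := he
    exact ⟨p, hp, hd.descend_clique w 1 u c p hwu hwc h2 (hc2 u huτ) h1⟩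
  · obtain ⟨h1, p, hp, h2, h3⟩ := hard j hj he
    have e1 := hc1 (q j) (by
      simp only [Finset.mem_insert, Finset.mem_filter, Finset.mem_image, Finset.mem_range]
      exact Or.inr ⟨j, ⟨hj, he⟩, rfl⟩)
    exact ⟨p, hp, hd.descend_clique (q j) 1 u c p h1 e1 h3 (hc2 u huτ) h2⟩

theorem isDescending_thickeningInter (hd : IsSDMetric d) (hY : ∀ j < n, IsDescending d (Y j))
    (hYY : ∀ i j, i < j → j < n → Y i ⊆ thickening d (Y j)) :
    IsDescending d (thickeningInter d Y n) := by
  classical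
  intro w hw i
  induction i with
  | zero =>
    exact fun τ h1 _ u _ _ => ⟨w, hw, by simp [hd.self_eq], fun x hx => by
      rw [hd.symm, h1 x hx]⟩
  | succ i ih =>
    intro τ h1 h2 u hu huZ
    rcases i with _ | i
    · exact hd.thickeningInter_descend_two hY hYY hw huZ h1 h2 hu
    · obtain ⟨s, hs, h3, h4⟩ := hd.thickeningInter_exists_step hY hYY hw huZ (h1 u hu)
      obtain ⟨t, h5, h6⟩ := hd.exists_common w _ τ ⟨u, hu⟩ h1 h2
      have h7 := hd.descend_clique w _ u s t (h1 u hu) h3 h5 h4 (h6 u hu)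
      have e1 := hd.tri w s u
      have e2 := hd.tri w t u
      have e3 := h6 u hu
      have e4 := h1 u hu
      have e5 := hd.symm s u
      have e6 := hd.symm t u
      obtain ⟨t1, h8, h9, h10⟩ := ih {s, t} (by
          intro x hx
          simp only [Finset.mem_insert, Finset.mem_singleton] at hx
          rcases hx with rfl | rfl <;> omega)
        (by
          intro x hx y hy
          simp only [Finset.mem_insert, Finset.mem_singleton] at hx hy
          rcases hx with rfl | rfl <;> rcases hy with rfl | rfl
          · simp [hd.self_eq]
          · exact h7
          · rw [hd.symm]; exact h7
          · simp [hd.self_eq]) s (by simp) hs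
      have h11 := h10 t (by simp)
      rw [hd.symm] at h11
      obtain ⟨y, hy, h12, h13⟩ := hd.thickeningInter_descend_two hY hYY h8 huZ (τ := τ)
        (by
          intro x hx
          have e7 := hd.tri t1 t x
          have e8 := h6 x hx
          rw [hd.symm] at e8
          have e9 := hd.tri w t1 x
          have e10 := h1 x hx
          omega) h2 hu
      have := hd.tri w t1 y
      exact ⟨y, hy, by omega, h13⟩

end IsSDMetric

/-- Simplicial chains modulo `2` (the empty simplex included). -/
abbrev ModTwoChain (T : Type*) := Finset T →₀ ZMod 2

namespace ModTwoChain

variable {T T' : Type*}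

theorem add_self_eq_zero (c : ModTwoChain T) : c + c = 0 := by
  ext s
  exact CharTwo.add_self_eq_zero (c s)

/-- The chain consisting of a single simplex. -/
noncomputable abbrev of (s : Finset T) : ModTwoChain T := Finsupp.single s 1

/-- The linear extension of a map defined on simplices. -/
noncomputable abbrev ext (F : Finset T → ModTwoChain T') :
    ModTwoChain T →ₗ[ZMod 2] ModTwoChain T' :=
  Finsupp.linearCombination (ZMod 2) F

theorem ext_of (F : Finset T → ModTwoChain T') (s : Finset T) : ext F (of s) = F s := by
  simp [ext]

/-- The chains supported in a set of simplices. -/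
noncomputable abbrev supp (K : Set (Finset T)) : Submodule (ZMod 2) (ModTwoChain T) :=
  Finsupp.supported (ZMod 2) (ZMod 2) K

theorem of_mem_supp {K : Set (Finset T)} {s : Finset T} (h : s ∈ K) : of s ∈ supp K :=
  Finsupp.single_mem_supported _ _ h

theorem supp_mono {K L : Set (Finset T)} (h : K ⊆ L) : supp K ≤ supp L :=
  Finsupp.supported_mono h

/-- To check a linear statement for the chains supported in `K`, it is enough to check it for the
simplices of `K`. -/
theorem supp_le {K : Set (Finset T)} {P : Submodule (ZMod 2) (ModTwoChain T)}
    (h : ∀ s ∈ K, of s ∈ P) : supp K ≤ P := by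
  rw [supp, Finsupp.supported_eq_span_single, Submodule.span_le]
  rintro _ ⟨s, hs, rfl⟩
  exact h s hs

theorem ext_mem_supp {K : Set (Finset T)} {L : Set (Finset T')} {F : Finset T → ModTwoChain T'}
    (h : ∀ s ∈ K, F s ∈ supp L) {c : ModTwoChain T} (hc : c ∈ supp K) : ext F c ∈ supp L := by
  have : supp K ≤ (supp L).comap (ext F) := supp_le fun s hs => by
    rw [Submodule.mem_comap, ext_of]
    exact h s hs
  exact this hc

theorem eq_on_supp {K : Set (Finset T)} {A B : ModTwoChain T →ₗ[ZMod 2] ModTwoChain T'}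
    (h : ∀ s ∈ K, A (of s) = B (of s)) {c : ModTwoChain T} (hc : c ∈ supp K) : A c = B c := by
  have : supp K ≤ LinearMap.eqLocus A B := supp_le h
  exact this hc

/-- The trace of an endomorphism on the chains supported in a finite set of simplices. -/
noncomputable def tr (K : Finset (Finset T)) (A : ModTwoChain T →ₗ[ZMod 2] ModTwoChain T) :
    ZMod 2 := ∑ s ∈ K, A (of s) s

theorem tr_comp_comm (K : Finset (Finset T)) (A B : ModTwoChain T →ₗ[ZMod 2] ModTwoChain T)
    (hA : ∀ c ∈ supp (K : Set (Finset T)), A c ∈ supp (K : Set (Finset T)))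
    (hB : ∀ c ∈ supp (K : Set (Finset T)), B c ∈ supp (K : Set (Finset T))) :
    tr K (A ∘ₗ B) = tr K (B ∘ₗ A) := by
  have expand : ∀ (A : ModTwoChain T →ₗ[ZMod 2] ModTwoChain T) (c : ModTwoChain T),
      c ∈ supp (K : Set (Finset T)) → ∀ s, A c s = ∑ t ∈ K, c t * A (of t) s := by
    intro A c hc s
    have e : c = ∑ t ∈ K, c t • of t := by
      conv_lhs => rw [← Finsupp.sum_single c]
      rw [Finsupp.sum_of_support_subset c (s := K) (by simpa [Finsupp.mem_supported] using hc) _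
        (by simp)]
      exact Finset.sum_congr rfl fun t _ => by simp [of]
    conv_lhs => rw [e]
    rw [map_sum, Finsupp.finsetSum_apply]
    exact Finset.sum_congr rfl fun t _ => by rw [map_smul]; rfl
  unfold tr
  have h1 : ∀ s ∈ K, (A ∘ₗ B) (of s) s = ∑ t ∈ K, B (of s) t * A (of t) s := fun s hs =>
    expand A _ (hB _ (of_mem_supp hs)) s
  have h2 : ∀ s ∈ K, (B ∘ₗ A) (of s) s = ∑ t ∈ K, A (of s) t * B (of t) s := fun s hs =>
    expand B _ (hA _ (of_mem_supp hs)) s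
  rw [Finset.sum_congr rfl h1, Finset.sum_congr rfl h2, Finset.sum_comm]
  exact Finset.sum_congr rfl fun s _ => Finset.sum_congr rfl fun t _ => mul_comm _ _

variable [DecidableEq T]

/-- The boundary operator of the augmented chain complex. -/
noncomputable def bd : ModTwoChain T →ₗ[ZMod 2] ModTwoChain T :=
  Finsupp.linearCombination (ZMod 2) fun s => ∑ v ∈ s, of (s.erase v)

theorem bd_of (s : Finset T) : bd (of s) = ∑ v ∈ s, of (s.erase v) := by
  simp [bd]

theorem ext_bd_of (F : Finset T → ModTwoChain T') (s : Finset T) :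
    ext F (bd (of s)) = ∑ v ∈ s, F (s.erase v) := by
  simp [bd_of, map_sum]

theorem sum_erase_erase (F : Finset T → ModTwoChain T') (s : Finset T) :
    ∑ v ∈ s, ∑ w ∈ s.erase v, F ((s.erase v).erase w) = 0 := by
  rw [Finset.sum_sigma']
  refine Finset.sum_involution (fun a _ => ⟨a.2, a.1⟩) ?_ ?_ ?_ ?_
  · intro a _
    rw [Finset.erase_right_comm]
    exact add_self_eq_zero _
  · intro a ha _ h
    simp only [Finset.mem_sigma, Finset.mem_erase] at ha
    exact ha.2.1 (congrArg Sigma.fst h)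
  · intro a ha
    simp only [Finset.mem_sigma, Finset.mem_erase] at ha ⊢
    exact ⟨ha.2.2, ha.2.1.symm, ha.1⟩
  · intro a _
    rfl

/-- A set of simplices is down-closed if it contains with a simplex all its facets. -/
def DownClosed (K : Set (Finset T)) : Prop := ∀ s ∈ K, ∀ v ∈ s, s.erase v ∈ K

/-- Every cycle supported in `K` is the boundary of a chain supported in `K`. -/
def Acyclic (K : Set (Finset T)) : Prop := ∀ c ∈ supp K, bd c = 0 → ∃ b ∈ supp K, bd b = c

theorem acyclic_of_cone {K : Set (Finset T)} (a : T) (h : ∀ s ∈ K, insert a s ∈ K) :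
    Acyclic K := by
  intro c hc hb
  let S : Finset T → ModTwoChain T := fun s => if a ∈ s then 0 else of (insert a s)
  refine ⟨ext S c, ext_mem_supp (K := K) (fun s hs => ?_) hc, ?_⟩
  · by_cases has : a ∈ s
    · simp [S, has]
    · simp only [S, has, if_false]
      exact of_mem_supp (h s hs)
  · have key : bd ∘ₗ ext S + ext S ∘ₗ bd = (LinearMap.id : ModTwoChain T →ₗ[ZMod 2] _) := by
      refine Finsupp.lhom_ext' fun s => LinearMap.ext_ring ?_
      change bd (ext S (of s)) + ext S (bd (of s)) = of s
      rw [ext_of, ext_bd_of]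
      by_cases has : a ∈ s
      · simp only [S, has, if_true, map_zero, zero_add]
        rw [Finset.sum_eq_single a]
        · simp [Finset.insert_erase has]
        · intro v _ hva
          simp [hva.symm, has]
        · exact fun h => absurd has h
      · simp only [S, has, if_false]
        rw [bd_of, Finset.sum_insert has, Finset.erase_insert has, add_assoc,
          ← Finset.sum_add_distrib, Finset.sum_eq_zero, add_zero]
        intro v hv
        have hva : a ≠ v := fun e => has (e ▸ hv)
        rw [if_neg (by simp [has]), Finset.erase_insert_of_ne hva, add_self_eq_zero]
    have := LinearMap.congr_fun key c
    simpa [hb] using this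

variable [DecidableEq T']

open Classical in
/-- The recursive construction behind the method of acyclic carriers. -/
noncomputable def fill (Φ : Finset T → Set (Finset T')) (R : Finset T → ModTwoChain T')
    (c₀ : ModTwoChain T') (s : Finset T) : ModTwoChain T' :=
  if s = ∅ then c₀ else
    if h : ∃ b ∈ supp (Φ s), bd b = R s + ∑ v ∈ s.attach, fill Φ R c₀ (s.erase v.1) then h.choose
    else 0
  termination_by s.card
  decreasing_by exact Finset.card_erase_lt_of_mem v.2

theorem fill_empty (Φ : Finset T → Set (Finset T')) (R : Finset T → ModTwoChain T')
    (c₀ : ModTwoChain T') : fill Φ R c₀ ∅ = c₀ := by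
  rw [fill]
  simp

/-- The method of acyclic carriers. -/
theorem exists_fill {K : Set (Finset T)} (hK : DownClosed K) (Φ : Finset T → Set (Finset T'))
    (hmono : ∀ s ∈ K, ∀ v ∈ s, Φ (s.erase v) ⊆ Φ s)
    (hacyc : ∀ s ∈ K, s.Nonempty → Acyclic (Φ s))
    (R : Finset T → ModTwoChain T') (hR : ∀ s ∈ K, R s ∈ supp (Φ s))
    (hbR : ∀ s ∈ K, bd (R s) = ∑ v ∈ s, R (s.erase v))
    (c₀ : ModTwoChain T') (hc₀ : c₀ ∈ supp (Φ ∅)) (hbc₀ : bd c₀ = R ∅) :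
    ∃ F : Finset T → ModTwoChain T', F ∅ = c₀ ∧ (∀ s ∈ K, F s ∈ supp (Φ s)) ∧
      ∀ s ∈ K, bd (F s) = R s + ∑ v ∈ s, F (s.erase v) := by
  have key : ∀ s ∈ K, fill Φ R c₀ s ∈ supp (Φ s) ∧
      bd (fill Φ R c₀ s) = R s + ∑ v ∈ s, fill Φ R c₀ (s.erase v) := by
    intro s
    induction s using Finset.strongInduction with
    | _ s ih =>
    intro hs
    rcases s.eq_empty_or_nonempty with rfl | hne
    · rw [fill_empty]
      simp [hc₀, hbc₀]
    · have hex : ∃ b ∈ supp (Φ s), bd b = R s + ∑ v ∈ s, fill Φ R c₀ (s.erase v) := by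
        refine hacyc s hs hne _ ?_ ?_
        · refine Submodule.add_mem _ (hR s hs) (Submodule.sum_mem _ fun v hv => ?_)
          exact supp_mono (hmono s hs v hv) (ih _ (Finset.erase_ssubset hv) (hK s hs v hv)).1
        · rw [map_add, map_sum, hbR s hs, Finset.sum_congr rfl fun v hv =>
            (ih _ (Finset.erase_ssubset hv) (hK s hs v hv)).2, Finset.sum_add_distrib,
            sum_erase_erase, add_zero, add_self_eq_zero]
      rw [← Finset.sum_attach] at hex
      have e : fill Φ R c₀ s = hex.choose := by
        rw [fill]
        simp only [hne.ne_empty, if_false]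
        rw [dif_pos hex]
      rw [← Finset.sum_attach, e]
      exact hex.choose_spec
  exact ⟨fill Φ R c₀, fill_empty _ _ _, fun s hs => (key s hs).1, fun s hs => (key s hs).2⟩

theorem bd_ext {K : Set (Finset T)} {F R : Finset T → ModTwoChain T'}
    (h : ∀ s ∈ K, bd (F s) = R s + ∑ v ∈ s, F (s.erase v)) {c : ModTwoChain T}
    (hc : c ∈ supp K) : bd (ext F c) = ext R c + ext F (bd c) := by
  refine eq_on_supp (A := bd ∘ₗ ext F) (B := ext R + ext F ∘ₗ bd) (fun s hs => ?_) hc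
  change bd (ext F (of s)) = ext R (of s) + ext F (bd (of s))
  rw [ext_of, ext_of, ext_bd_of, h s hs]

theorem bd_mem_supp {K : Set (Finset T)} (hK : DownClosed K) {c : ModTwoChain T}
    (hc : c ∈ supp K) : bd c ∈ supp K :=
  ext_mem_supp (fun s hs => Submodule.sum_mem _ fun v hv => of_mem_supp (hK s hs v hv)) hc

/-- A chain map carried by an acyclic carrier. -/
theorem exists_chainMap {K : Set (Finset T)} (hK : DownClosed K) (Φ : Finset T → Set (Finset T'))
    (hmono : ∀ s ∈ K, ∀ v ∈ s, Φ (s.erase v) ⊆ Φ s)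
    (hacyc : ∀ s ∈ K, s.Nonempty → Acyclic (Φ s)) (hempty : ∅ ∈ Φ ∅) :
    ∃ F : Finset T → ModTwoChain T', F ∅ = of ∅ ∧ (∀ s ∈ K, F s ∈ supp (Φ s)) ∧
      ∀ c ∈ supp K, bd (ext F c) = ext F (bd c) := by
  obtain ⟨F, h1, h2, h3⟩ := exists_fill hK Φ hmono hacyc 0 (fun _ _ => Submodule.zero_mem _)
    (by simp) (of ∅) (of_mem_supp hempty) (by simp [bd_of])
  refine ⟨F, h1, h2, fun c hc => ?_⟩
  rw [bd_ext h3 hc, show ext (0 : Finset T → ModTwoChain T') c = 0 by simp [ext], zero_add]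

/-- A criterion for acyclicity: `K` is a homotopy retract of the acyclic `L`. -/
theorem acyclic_of_carriers {K : Set (Finset T)} {L : Set (Finset T')} (hK : DownClosed K)
    (hL : DownClosed L) (hLa : Acyclic L) (f : Finset T → Set (Finset T'))
    (g : Finset T' → Set (Finset T)) (Φ : Finset T → Set (Finset T))
    (hf : ∀ s ∈ K, f s ⊆ L) (hfm : ∀ s ∈ K, ∀ v ∈ s, f (s.erase v) ⊆ f s)
    (hfa : ∀ s ∈ K, s.Nonempty → Acyclic (f s)) (hfe : ∅ ∈ f ∅)
    (hg : ∀ s ∈ L, g s ⊆ K) (hgm : ∀ s ∈ L, ∀ v ∈ s, g (s.erase v) ⊆ g s)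
    (hga : ∀ s ∈ L, s.Nonempty → Acyclic (g s)) (hge : ∅ ∈ g ∅)
    (hΦ : ∀ s ∈ K, Φ s ⊆ K) (hΦm : ∀ s ∈ K, ∀ v ∈ s, Φ (s.erase v) ⊆ Φ s)
    (hΦa : ∀ s ∈ K, s.Nonempty → Acyclic (Φ s)) (hΦs : ∀ s ∈ K, s ∈ Φ s)
    (hgf : ∀ s ∈ K, ∀ t ∈ f s, g t ⊆ Φ s) : Acyclic K := by
  obtain ⟨F, hF0, hF1, hF2⟩ := exists_chainMap hK f hfm hfa hfe
  obtain ⟨G, hG0, hG1, hG2⟩ := exists_chainMap hL g hgm hga hge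
  have hFL : ∀ c ∈ supp K, ext F c ∈ supp L := fun c hc =>
    ext_mem_supp (fun s hs => supp_mono (hf s hs) (hF1 s hs)) hc
  obtain ⟨H, -, hH1, hH2⟩ := exists_fill hK Φ hΦm hΦa (fun s => of s + ext G (F s))
    (fun s hs => Submodule.add_mem _ (of_mem_supp (hΦs s hs)) (ext_mem_supp (K := f s)
      (fun t ht => supp_mono (hgf s hs t ht) (hG1 t (hf s hs ht))) (hF1 s hs)))
    (by
      intro s hs
      have h1 := hFL _ (of_mem_supp hs)
      have h2 := hF2 _ (of_mem_supp hs)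
      rw [ext_of] at h1 h2
      rw [map_add, hG2 _ h1, h2, ext_bd_of, bd_of, map_sum, Finset.sum_add_distrib]) 0
    (Submodule.zero_mem _) (by simp only [hF0, ext_of, hG0, add_self_eq_zero, map_zero])
  intro z hz hbz
  obtain ⟨b, hb, hbb⟩ := hLa (ext F z) (hFL z hz) (by rw [hF2 z hz, hbz, map_zero])
  refine ⟨ext H z + ext G b, Submodule.add_mem _
    (ext_mem_supp (fun s hs => supp_mono (hΦ s hs) (hH1 s hs)) hz)
    (ext_mem_supp (fun s hs => supp_mono (hg s hs) (hG1 s hs)) hb), ?_⟩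
  have e : ext (fun s => of s + ext G (F s)) z = z + ext G (ext F z) :=
    eq_on_supp (K := K) (A := ext fun s => of s + ext G (F s))
      (B := LinearMap.id + ext G ∘ₗ ext F) (fun s _ => by
        change ext (fun s => of s + ext G (F s)) (of s) = of s + ext G (ext F (of s))
        rw [ext_of, ext_of]) hz
  rw [map_add, bd_ext hH2 hz, hbz, map_zero, add_zero, hG2 b hb, hbb, e, add_assoc,
    add_self_eq_zero, add_zero]

/-- The Lefschetz fixed point theorem for a chain endomorphism of a finite acyclic complex. -/
theorem exists_mem_of_acyclic {K : Set (Finset T)} (hfin : K.Finite) (hK : DownClosed K)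
    (hKa : Acyclic K) (hempty : ∅ ∈ K) (M : ModTwoChain T →ₗ[ZMod 2] ModTwoChain T)
    (hM : ∀ c ∈ supp K, M c ∈ supp K) (hMb : ∀ c ∈ supp K, bd (M c) = M (bd c))
    (hM0 : M (of ∅) = of ∅) : ∃ s ∈ K, s.Nonempty ∧ M (of s) s ≠ 0 := by
  by_contra! hcon
  obtain ⟨K, rfl⟩ := hfin.exists_finset_coe
  obtain ⟨c₀, hc₀, hbc₀⟩ := hKa (of ∅) (of_mem_supp hempty) (by simp [bd_of])
  obtain ⟨S, -, hS1, hS2⟩ := exists_fill hK (fun _ => (K : Set (Finset T)))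
    (fun _ _ _ _ => subset_rfl) (fun _ _ _ => hKa) of (fun s hs => of_mem_supp hs)
    (fun s _ => bd_of s) c₀ hc₀ hbc₀
  have hS : ∀ c ∈ supp (K : Set (Finset T)), ext S c ∈ supp (K : Set (Finset T)) :=
    fun c hc => ext_mem_supp hS1 hc
  have hb : ∀ c ∈ supp (K : Set (Finset T)), bd c ∈ supp (K : Set (Finset T)) :=
    fun c hc => bd_mem_supp hK hc
  have h1 : tr K M = 1 := by
    unfold tr
    rw [Finset.sum_eq_single ∅]
    · rw [hM0]
      simp [of]
    · intro s hs hne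
      exact hcon s hs (Finset.nonempty_iff_ne_empty.2 hne)
    · exact fun h => absurd hempty h
  have h2 : tr K M = tr K (bd ∘ₗ (M ∘ₗ ext S)) + tr K ((M ∘ₗ ext S) ∘ₗ bd) := by
    unfold tr
    rw [← Finset.sum_add_distrib]
    refine Finset.sum_congr rfl fun s hs => ?_
    change M (of s) s = bd (M (ext S (of s))) s + M (ext S (bd (of s))) s
    have e1 := bd_ext hS2 (of_mem_supp hs)
    rw [ext_of of] at e1
    rw [hMb _ (hS _ (of_mem_supp hs)), e1, map_add, Finsupp.add_apply, add_assoc,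
      CharTwo.add_self_eq_zero, add_zero]
  rw [tr_comp_comm K bd _ hb (fun c hc => hM (ext S c) (hS c hc)),
    CharTwo.add_self_eq_zero, h1] at h2
  exact one_ne_zero h2

end ModTwoChain

open ModTwoChain

section OrderComplex

variable {α β : Type*}

/-- The finite chains, with respect to inclusion, of a family of finite sets. -/
def orderChains (U : Set (Finset α)) : Set (Finset (Finset α)) :=
  {c | (∀ x ∈ c, x ∈ U) ∧ ∀ x ∈ c, ∀ y ∈ c, x ⊆ y ∨ y ⊆ x}

theorem orderChains_mono {U W : Set (Finset α)} (h : U ⊆ W) : orderChains U ⊆ orderChains W :=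
  fun _ hc => ⟨fun x hx => h (hc.1 x hx), hc.2⟩

theorem empty_mem_orderChains (U : Set (Finset α)) : ∅ ∈ orderChains U := by
  simp [orderChains]

theorem exists_min_of_mem_orderChains {U : Set (Finset α)} {c : Finset (Finset α)}
    (hc : c ∈ orderChains U) (hne : c.Nonempty) : ∃ m ∈ c, ∀ x ∈ c, m ⊆ x := by
  obtain ⟨m, hm, h⟩ := Finset.exists_min_image c Finset.card hne
  refine ⟨m, hm, fun x hx => ?_⟩
  rcases hc.2 m hm x hx with h1 | h1
  · exact h1
  · rw [Finset.eq_of_subset_of_card_le h1 (h x hx)]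

theorem exists_max_of_mem_orderChains {U : Set (Finset α)} {c : Finset (Finset α)}
    (hc : c ∈ orderChains U) (hne : c.Nonempty) : ∃ m ∈ c, ∀ x ∈ c, x ⊆ m := by
  obtain ⟨m, hm, h⟩ := Finset.exists_max_image c Finset.card hne
  refine ⟨m, hm, fun x hx => ?_⟩
  rcases hc.2 m hm x hx with h1 | h1
  · rw [Finset.eq_of_subset_of_card_le h1 (h x hx)]
  · exact h1

variable [DecidableEq α] [DecidableEq β]

theorem downClosed_orderChains (U : Set (Finset α)) : DownClosed (orderChains U) :=
  fun _ hc _ _ => ⟨fun x hx => hc.1 x (Finset.mem_of_mem_erase hx), fun x hx y hy =>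
    hc.2 x (Finset.mem_of_mem_erase hx) y (Finset.mem_of_mem_erase hy)⟩

theorem acyclic_orderChains_of_center {U : Set (Finset α)} {M : Finset α} (hM : M ∈ U)
    (h : ∀ x ∈ U, x ⊆ M ∨ M ⊆ x) : Acyclic (orderChains U) := by
  refine acyclic_of_cone M fun c hc => ⟨fun x hx => ?_, fun x hx y hy => ?_⟩
  · rcases Finset.mem_insert.1 hx with rfl | hx
    · exact hM
    · exact hc.1 x hx
  · rcases Finset.mem_insert.1 hx with ex | hx <;> rcases Finset.mem_insert.1 hy with ey | hy
    · rw [ex, ey]; exact Or.inl subset_rfl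
    · rw [ex]; exact (h y (hc.1 y hy)).symm
    · rw [ey]; exact h x (hc.1 x hx)
    · exact hc.2 x hx y hy

theorem acyclic_orderChains_of_carriers {U : Set (Finset α)} {W : Set (Finset β)}
    (hW : Acyclic (orderChains W)) (f : Finset (Finset α) → Set (Finset β))
    (g : Finset (Finset β) → Set (Finset α)) (Φ : Finset (Finset α) → Set (Finset α))
    (hf : ∀ c, f c ⊆ W) (hfm : Monotone f)
    (hfa : ∀ c ∈ orderChains U, c.Nonempty → Acyclic (orderChains (f c)))
    (hg : ∀ c, g c ⊆ U) (hgm : Monotone g)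
    (hga : ∀ c ∈ orderChains W, c.Nonempty → Acyclic (orderChains (g c)))
    (hΦ : ∀ c, Φ c ⊆ U) (hΦm : Monotone Φ)
    (hΦa : ∀ c ∈ orderChains U, c.Nonempty → Acyclic (orderChains (Φ c)))
    (hΦs : ∀ c ∈ orderChains U, ∀ x ∈ c, x ∈ Φ c)
    (hgf : ∀ c ∈ orderChains U, ∀ t ∈ orderChains (f c), g t ⊆ Φ c) :
    Acyclic (orderChains U) :=
  acyclic_of_carriers (downClosed_orderChains U) (downClosed_orderChains W) hW
    (fun c => orderChains (f c)) (fun c => orderChains (g c)) (fun c => orderChains (Φ c))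
    (fun c _ => orderChains_mono (hf c))
    (fun _ _ _ _ => orderChains_mono (hfm (Finset.erase_subset _ _))) hfa
    (empty_mem_orderChains _) (fun c _ => orderChains_mono (hg c))
    (fun _ _ _ _ => orderChains_mono (hgm (Finset.erase_subset _ _))) hga
    (empty_mem_orderChains _) (fun c _ => orderChains_mono (hΦ c))
    (fun _ _ _ _ => orderChains_mono (hΦm (Finset.erase_subset _ _))) hΦa
    (fun c hc => ⟨hΦs c hc, hc.2⟩) (fun c hc t ht => orderChains_mono (hgf c hc t ht))

end OrderComplex

section Cliques

variable {V : Type*} {d : V → V → ℕ}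

/-- The nonempty finite cliques in a set. -/
def cliques (d : V → V → ℕ) (A : Set V) : Set (Finset V) :=
  {σ | σ.Nonempty ∧ (∀ x ∈ σ, x ∈ A) ∧ ∀ x ∈ σ, ∀ y ∈ σ, d x y ≤ 1}

variable [DecidableEq V]

theorem IsSDMetric.acyclic_cliques_of_cone (hd : IsSDMetric d) {A : Set V} {e : V} (he : e ∈ A)
    (h : ∀ x ∈ A, d e x ≤ 1) : Acyclic (orderChains (cliques d A)) := by
  have hins : ∀ σ ∈ cliques d A, insert e σ ∈ cliques d A := by
    intro σ hσ
    refine ⟨by simp, fun x hx => ?_, fun x hx y hy => ?_⟩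
    · rcases Finset.mem_insert.1 hx with rfl | hx
      · exact he
      · exact hσ.2.1 x hx
    · rcases Finset.mem_insert.1 hx with ex | hx <;> rcases Finset.mem_insert.1 hy with ey | hy
      · rw [ex, ey]; exact h e he
      · rw [ex]; exact h y (hσ.2.1 y hy)
      · rw [ey, hd.symm]; exact h x (hσ.2.1 x hx)
      · exact hσ.2.2 x hx y hy
  have hsing : ({e} : Finset V) ∈ cliques d A :=
    ⟨by simp, by simpa using he, by simp [hd.self_eq]⟩
  refine acyclic_orderChains_of_carriers (W := {σ | σ ∈ cliques d A ∧ e ∈ σ})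
    (acyclic_orderChains_of_center (M := {e}) ⟨hsing, by simp⟩
      fun x hx => Or.inr (by simpa using hx.2))
    (fun c => {σ | (σ ∈ cliques d A ∧ e ∈ σ) ∧ ∃ ρ ∈ c, σ ⊆ insert e ρ})
    (fun c => {σ | σ ∈ cliques d A ∧ ∃ ρ ∈ c, σ ⊆ ρ})
    (fun c => {σ | σ ∈ cliques d A ∧ ∃ ρ ∈ c, σ ⊆ insert e ρ})
    (fun c σ hσ => hσ.1) (fun c c' hcc σ hσ => ⟨hσ.1, hσ.2.imp fun ρ hρ => ⟨hcc hρ.1, hρ.2⟩⟩)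
    (fun c hc hne => ?_)
    (fun c σ hσ => hσ.1) (fun c c' hcc σ hσ => ⟨hσ.1, hσ.2.imp fun ρ hρ => ⟨hcc hρ.1, hρ.2⟩⟩)
    (fun c hc hne => ?_)
    (fun c σ hσ => hσ.1) (fun c c' hcc σ hσ => ⟨hσ.1, hσ.2.imp fun ρ hρ => ⟨hcc hρ.1, hρ.2⟩⟩)
    (fun c hc hne => ?_) (fun c hc x hx => ⟨hc.1 x hx, x, hx, Finset.subset_insert _ _⟩)
    (fun c hc t ht σ hσ => ?_)
  · obtain ⟨m, hm, hmax⟩ := exists_max_of_mem_orderChains hc hne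
    refine acyclic_orderChains_of_center (M := insert e m)
      ⟨⟨hins m (hc.1 m hm), by simp⟩, m, hm, subset_rfl⟩ fun x hx => Or.inl ?_
    obtain ⟨ρ, hρ, h1⟩ := hx.2
    exact h1.trans (Finset.insert_subset_insert _ (hmax ρ hρ))
  · obtain ⟨m, hm, hmax⟩ := exists_max_of_mem_orderChains hc hne
    refine acyclic_orderChains_of_center (M := m)
      ⟨(hc.1 m hm).1, m, hm, subset_rfl⟩ fun x hx => Or.inl ?_
    obtain ⟨ρ, hρ, h1⟩ := hx.2
    exact h1.trans (hmax ρ hρ)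
  · obtain ⟨m, hm, hmax⟩ := exists_max_of_mem_orderChains hc hne
    refine acyclic_orderChains_of_center (M := insert e m)
      ⟨hins m (hc.1 m hm), m, hm, subset_rfl⟩ fun x hx => Or.inl ?_
    obtain ⟨ρ, hρ, h1⟩ := hx.2
    exact h1.trans (Finset.insert_subset_insert _ (hmax ρ hρ))
  · obtain ⟨ρ, hρ, h1⟩ := hσ.2
    obtain ⟨ρ', hρ', h2⟩ := (ht.1 ρ hρ).2
    exact ⟨hσ.1, ρ', hρ', h1.trans h2⟩

theorem IsSDMetric.acyclic_cliques_inter_ball (hd : IsSDMetric d) {Y : Set V}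
    (hY : IsDescending d Y) {v : V} (hv : v ∈ Y) (D : ℕ) :
    Acyclic (orderChains (cliques d (Y ∩ {x | d v x ≤ D}))) := by
  induction D with
  | zero =>
    exact hd.acyclic_cliques_of_cone (e := v) ⟨hv, (hd.self_eq v).le⟩
      fun x hx => (show d v x ≤ 0 from hx.2).trans zero_le_one
  | succ D ih =>
    have hsub : Y ∩ {x | d v x ≤ D} ⊆ Y ∩ {x | d v x ≤ D + 1} :=
      fun x hx => ⟨hx.1, Nat.le_succ_of_le hx.2⟩
    have hmono : cliques d (Y ∩ {x | d v x ≤ D}) ⊆ cliques d (Y ∩ {x | d v x ≤ D + 1}) :=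
      fun σ hσ => ⟨hσ.1, fun x hx => hsub (hσ.2.1 x hx), hσ.2.2⟩
    have hset : ∀ (A : Set V) (c : Finset (Finset V)) (m : Finset V), m ∈ c →
        (∀ x ∈ c, m ⊆ x) → {σ | σ ∈ cliques d A ∧ ∃ ρ ∈ c, ∀ x ∈ σ, ∀ y ∈ ρ, d y x ≤ 1} =
          cliques d {x | x ∈ A ∧ ∀ y ∈ m, d y x ≤ 1} := by
      intro A c m hm hmin
      ext σ
      constructor
      · rintro ⟨h1, ρ, hρ, h2⟩
        exact ⟨h1.1, fun x hx => ⟨h1.2.1 x hx, fun y hy => h2 x hx y (hmin ρ hρ hy)⟩, h1.2.2⟩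
      · rintro ⟨h1, h2, h3⟩
        exact ⟨⟨h1, fun x hx => (h2 x hx).1, h3⟩, m, hm, fun x hx => (h2 x hx).2⟩
    refine acyclic_orderChains_of_carriers ih
      (fun c => {σ | σ ∈ cliques d (Y ∩ {x | d v x ≤ D}) ∧
        ∃ ρ ∈ c, ∀ x ∈ σ, ∀ y ∈ ρ, d y x ≤ 1})
      (fun c => {σ | σ ∈ cliques d (Y ∩ {x | d v x ≤ D + 1}) ∧ ∃ ρ ∈ c, σ ⊆ ρ})
      (fun c => {σ | σ ∈ cliques d (Y ∩ {x | d v x ≤ D + 1}) ∧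
        ∃ ρ ∈ c, ∀ x ∈ σ, ∀ y ∈ ρ, d y x ≤ 1})
      (fun c σ hσ => hσ.1)
      (fun c c' hcc σ hσ => ⟨hσ.1, hσ.2.imp fun ρ hρ => ⟨hcc hρ.1, hρ.2⟩⟩)
      (fun c hc hne => ?_)
      (fun c σ hσ => hσ.1)
      (fun c c' hcc σ hσ => ⟨hσ.1, hσ.2.imp fun ρ hρ => ⟨hcc hρ.1, hρ.2⟩⟩)
      (fun c hc hne => ?_)
      (fun c σ hσ => hσ.1)
      (fun c c' hcc σ hσ => ⟨hσ.1, hσ.2.imp fun ρ hρ => ⟨hcc hρ.1, hρ.2⟩⟩)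
      (fun c hc hne => ?_)
      (fun c hc x hx => ⟨hc.1 x hx, x, hx, fun y hy z hz => (hc.1 x hx).2.2 z hz y hy⟩)
      (fun c hc t ht σ hσ => ?_)
    · obtain ⟨m, hm, hmin⟩ := exists_min_of_mem_orderChains hc hne
      have hmU := hc.1 m hm
      rw [hset _ c m hm hmin]
      by_cases htop : ∃ u ∈ m, d v u = D + 1
      · obtain ⟨u, hu, hvu⟩ := htop
        obtain ⟨y, hy, h1, h2⟩ := hY v hv D (m.filter fun x => d v x = D + 1)
          (fun x hx => (Finset.mem_filter.1 hx).2)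
          (fun x hx y hy => hmU.2.2 x (Finset.mem_filter.1 hx).1 y (Finset.mem_filter.1 hy).1)
          u (Finset.mem_filter.2 ⟨hu, hvu⟩) (hmU.2.1 u hu).1
        have huy := h2 u (Finset.mem_filter.2 ⟨hu, hvu⟩)
        refine hd.acyclic_cliques_of_cone (e := y) ⟨⟨hy, h1⟩, fun z hz => ?_⟩ fun x hx => ?_
        · have hz2 : d v z ≤ D + 1 := (hmU.2.1 z hz).2
          rcases hz2.lt_or_eq with h3 | h3
          · exact hd.descend_clique v D u z y hvu (by omega) h1 (hmU.2.2 u hu z hz) huy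
          · exact h2 z (Finset.mem_filter.2 ⟨hz, h3⟩)
        · exact hd.descend_clique v D u y x hvu h1 hx.1.2 huy (hx.2 u hu)
      · push Not at htop
        obtain ⟨e, he⟩ := hmU.1
        refine hd.acyclic_cliques_of_cone (e := e)
          ⟨⟨(hmU.2.1 e he).1, ?_⟩, fun y hy => hmU.2.2 y hy e he⟩ fun x hx => hx.2 e he
        have h1 : d v e ≤ D + 1 := (hmU.2.1 e he).2
        have h2 := htop e he
        change d v e ≤ D
        omega
    · obtain ⟨m, hm, hmax⟩ := exists_max_of_mem_orderChains hc hne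
      refine acyclic_orderChains_of_center (M := m)
        ⟨hmono (hc.1 m hm), m, hm, subset_rfl⟩ fun x hx => Or.inl ?_
      obtain ⟨ρ, hρ, h1⟩ := hx.2
      exact h1.trans (hmax ρ hρ)
    · obtain ⟨m, hm, hmin⟩ := exists_min_of_mem_orderChains hc hne
      have hmU := hc.1 m hm
      rw [hset _ c m hm hmin]
      obtain ⟨e, he⟩ := hmU.1
      exact hd.acyclic_cliques_of_cone (e := e)
        ⟨hmU.2.1 e he, fun y hy => hmU.2.2 y hy e he⟩ fun x hx => hx.2 e he
    · obtain ⟨ρ, hρ, h1⟩ := hσ.2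
      obtain ⟨ρ', hρ', h2⟩ := (ht.1 ρ hρ).2
      exact ⟨hσ.1, ρ', hρ', fun x hx => h2 x (h1 hx)⟩

/-- The poset of cliques in a finite nonempty descending set is acyclic. -/
theorem IsSDMetric.acyclic_cliques (hd : IsSDMetric d) {Y : Set V} (hY : IsDescending d Y)
    (hne : Y.Nonempty) (hfin : Y.Finite) : Acyclic (orderChains (cliques d Y)) := by
  obtain ⟨v, hv⟩ := hne
  obtain ⟨D, hD⟩ := (hfin.image (d v)).bddAbove
  have h := hd.acyclic_cliques_inter_ball hY hv D
  have e : Y ∩ {x | d v x ≤ D} = Y := Set.inter_eq_left.2 fun x hx => hD (Set.mem_image_of_mem _ hx)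
  rwa [e] at h

end Cliques

section Towers

variable {V : Type*} {d : V → V → ℕ}

/-- The towers of cliques: finite cliques of labelled points which use all the labels in
`[b₀, b₀ + k)` and no others, the points with label `b` being taken from `L b`. -/
def towers (d : V → V → ℕ) (b₀ : ℤ) (k : ℕ) (L : ℤ → Set V) : Set (Finset (V × ℤ)) :=
  {ρ | (∀ p ∈ ρ, b₀ ≤ p.2 ∧ p.2 < b₀ + k ∧ p.1 ∈ L p.2) ∧
    (∀ b, b₀ ≤ b → b < b₀ + k → ∃ x, (x, b) ∈ ρ) ∧ ∀ p ∈ ρ, ∀ q ∈ ρ, d p.1 q.1 ≤ 1}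

theorem filter_mem_towers {b₀ : ℤ} {k : ℕ} {L : ℤ → Set V} {ρ : Finset (V × ℤ)}
    (hρ : ρ ∈ towers d b₀ (k + 1) L) : (ρ.filter fun p => p.2 < b₀ + k) ∈ towers d b₀ k L := by
  refine ⟨fun p hp => ?_, fun b h1 h2 => ?_, fun p hp q hq => ?_⟩
  · obtain ⟨h1, h2⟩ := Finset.mem_filter.1 hp
    exact ⟨(hρ.1 p h1).1, h2, (hρ.1 p h1).2.2⟩
  · obtain ⟨x, hx⟩ := hρ.2.1 b h1 (by push_cast; omega)
    exact ⟨x, Finset.mem_filter.2 ⟨hx, h2⟩⟩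
  · exact hρ.2.2 p (Finset.mem_filter.1 hp).1 q (Finset.mem_filter.1 hq).1

variable [DecidableEq V]

theorem IsSDMetric.union_mem_towers (hd : IsSDMetric d) {b₀ : ℤ} {k : ℕ} {L : ℤ → Set V}
    {ρ₀ : Finset (V × ℤ)} (hρ₀ : ρ₀ ∈ towers d b₀ k L) {N : Finset V}
    (hN : N ∈ cliques d {x | x ∈ L (b₀ + k) ∧ ∀ p ∈ ρ₀, d p.1 x ≤ 1}) :
    ρ₀ ∪ N.image (fun x => (x, b₀ + (k : ℤ))) ∈ towers d b₀ (k + 1) L := by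
  refine ⟨fun p hp => ?_, fun b h1 h2 => ?_, fun p hp q hq => ?_⟩
  · rcases Finset.mem_union.1 hp with hp | hp
    · obtain ⟨h1, h2, h3⟩ := hρ₀.1 p hp
      exact ⟨h1, by push_cast; omega, h3⟩
    · obtain ⟨x, hx, rfl⟩ := Finset.mem_image.1 hp
      exact ⟨by simp, by simp, (hN.2.1 x hx).1⟩
  · by_cases hb : b < b₀ + k
    · obtain ⟨x, hx⟩ := hρ₀.2.1 b h1 hb
      exact ⟨x, Finset.mem_union_left _ hx⟩
    · obtain ⟨x, hx⟩ := hN.1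
      have : b = b₀ + k := by push_cast at h2; omega
      exact ⟨x, Finset.mem_union_right _ (Finset.mem_image.2 ⟨x, hx, by rw [this]⟩)⟩
  · rcases Finset.mem_union.1 hp with hp | hp <;> rcases Finset.mem_union.1 hq with hq | hq
    · exact hρ₀.2.2 p hp q hq
    · obtain ⟨x, hx, rfl⟩ := Finset.mem_image.1 hq
      exact (hN.2.1 x hx).2 p hp
    · obtain ⟨x, hx, rfl⟩ := Finset.mem_image.1 hp
      rw [hd.symm]
      exact (hN.2.1 x hx).2 q hq
    · obtain ⟨x, hx, rfl⟩ := Finset.mem_image.1 hp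
      obtain ⟨y, hy, rfl⟩ := Finset.mem_image.1 hq
      exact hN.2.2 x hx y hy

theorem IsSDMetric.acyclic_towers_above (hd : IsSDMetric d) {b₀ : ℤ} {k : ℕ} {L : ℤ → Set V}
    {ρ₀ : Finset (V × ℤ)} (hρ₀ : ρ₀ ∈ towers d b₀ k L)
    (h : Acyclic (orderChains (cliques d {x | x ∈ L (b₀ + k) ∧ ∀ p ∈ ρ₀, d p.1 x ≤ 1}))) :
    Acyclic (orderChains {ρ | ρ ∈ towers d b₀ (k + 1) L ∧ ρ₀ ⊆ ρ}) := by
  set A := {x | x ∈ L (b₀ + k) ∧ ∀ p ∈ ρ₀, d p.1 x ≤ 1} with hA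
  refine acyclic_orderChains_of_carriers h
    (fun c => {N | N ∈ cliques d A ∧ ∃ ρ ∈ c, ∀ x ∈ N, (x, b₀ + (k : ℤ)) ∈ ρ})
    (fun c => {ρ | (ρ ∈ towers d b₀ (k + 1) L ∧ ρ₀ ⊆ ρ) ∧
      ∃ N ∈ c, ρ ⊆ ρ₀ ∪ N.image (fun x => (x, b₀ + (k : ℤ)))})
    (fun c => {ρ | (ρ ∈ towers d b₀ (k + 1) L ∧ ρ₀ ⊆ ρ) ∧ ∃ ρ' ∈ c, ρ ⊆ ρ'})
    (fun c σ hσ => hσ.1)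
    (fun c c' hcc σ hσ => ⟨hσ.1, hσ.2.imp fun ρ hρ => ⟨hcc hρ.1, hρ.2⟩⟩)
    (fun c hc hne => ?_)
    (fun c σ hσ => hσ.1)
    (fun c c' hcc σ hσ => ⟨hσ.1, hσ.2.imp fun ρ hρ => ⟨hcc hρ.1, hρ.2⟩⟩)
    (fun c hc hne => ?_)
    (fun c σ hσ => hσ.1)
    (fun c c' hcc σ hσ => ⟨hσ.1, hσ.2.imp fun ρ hρ => ⟨hcc hρ.1, hρ.2⟩⟩)
    (fun c hc hne => ?_)
    (fun c hc x hx => ⟨hc.1 x hx, x, hx, subset_rfl⟩) (fun c hc t ht σ hσ => ?_)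
  · obtain ⟨m, hm, hmax⟩ := exists_max_of_mem_orderChains hc hne
    obtain ⟨hmT, hmρ⟩ := hc.1 m hm
    have hmem : ∀ x, x ∈ (m.filter fun p => p.2 = b₀ + (k : ℤ)).image Prod.fst ↔
        (x, b₀ + (k : ℤ)) ∈ m := by
      intro x
      simp only [Finset.mem_image, Finset.mem_filter]
      constructor
      · rintro ⟨⟨y, b⟩, ⟨h1, h2⟩, h3⟩
        simp only at h2 h3
        rw [← h2, ← h3]
        exact h1
      · exact fun hx => ⟨_, ⟨hx, rfl⟩, rfl⟩
    refine acyclic_orderChains_of_center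
      (M := (m.filter fun p => p.2 = b₀ + (k : ℤ)).image Prod.fst)
      ⟨⟨?_, fun x hx => ?_, fun x hx y hy => ?_⟩, m, hm, fun x hx => (hmem x).1 hx⟩
      fun N hN => Or.inl ?_
    · obtain ⟨x, hx⟩ := hmT.2.1 (b₀ + k) (by omega) (by push_cast; omega)
      exact ⟨x, (hmem x).2 hx⟩
    · have hx := (hmem x).1 hx
      exact ⟨(hmT.1 _ hx).2.2, fun p hp => hmT.2.2 p (hmρ hp) _ hx⟩
    · exact hmT.2.2 _ ((hmem x).1 hx) _ ((hmem y).1 hy)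
    · obtain ⟨ρ, hρ, h1⟩ := hN.2
      exact fun x hx => (hmem x).2 (hmax ρ hρ (h1 x hx))
  · obtain ⟨m, hm, hmax⟩ := exists_max_of_mem_orderChains hc hne
    refine acyclic_orderChains_of_center
      (M := ρ₀ ∪ m.image (fun x => (x, b₀ + (k : ℤ))))
      ⟨⟨hd.union_mem_towers hρ₀ (hc.1 m hm), Finset.subset_union_left⟩, m, hm, subset_rfl⟩
      fun x hx => Or.inl ?_
    obtain ⟨N, hN, h1⟩ := hx.2
    exact h1.trans (Finset.union_subset_union_right (Finset.image_subset_image (hmax N hN)))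
  · obtain ⟨m, hm, hmax⟩ := exists_max_of_mem_orderChains hc hne
    refine acyclic_orderChains_of_center (M := m) ⟨hc.1 m hm, m, hm, subset_rfl⟩
      fun x hx => Or.inl ?_
    obtain ⟨ρ, hρ, h1⟩ := hx.2
    exact h1.trans (hmax ρ hρ)
  · obtain ⟨N, hN, h1⟩ := hσ.2
    obtain ⟨ρ', hρ', h2⟩ := (ht.1 N hN).2
    refine ⟨hσ.1, ρ', hρ', h1.trans (Finset.union_subset (hc.1 ρ' hρ').2 fun p hp => ?_)⟩
    obtain ⟨x, hx, rfl⟩ := Finset.mem_image.1 hp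
    exact h2 x hx

/-- The poset of towers is acyclic if all the posets of possible extensions are. -/
theorem IsSDMetric.acyclic_towers (hd : IsSDMetric d) (b₀ : ℤ) (L : ℤ → Set V) (n : ℕ)
    (h : ∀ k < n, ∀ ρ₀ ∈ towers d b₀ k L,
      Acyclic (orderChains (cliques d {x | x ∈ L (b₀ + k) ∧ ∀ p ∈ ρ₀, d p.1 x ≤ 1}))) :
    Acyclic (orderChains (towers d b₀ n L)) := by
  induction n with
  | zero =>
    refine acyclic_orderChains_of_center (M := ∅)
      ⟨by simp, fun b h1 h2 => absurd h2 (by push_cast; omega), by simp⟩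
      fun x _ => Or.inr (Finset.empty_subset x)
  | succ k ih =>
    have hab : ∀ ρ₀ ∈ towers d b₀ k L,
        Acyclic (orderChains {ρ | ρ ∈ towers d b₀ (k + 1) L ∧ ρ₀ ⊆ ρ}) :=
      fun ρ₀ hρ₀ => hd.acyclic_towers_above hρ₀ (h k (by omega) ρ₀ hρ₀)
    obtain ⟨res, hsub, hmono, hmem⟩ : ∃ res : Finset (V × ℤ) → Finset (V × ℤ), (∀ ρ, res ρ ⊆ ρ) ∧
        Monotone res ∧ ∀ ρ ∈ towers d b₀ (k + 1) L, res ρ ∈ towers d b₀ k L :=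
      ⟨fun ρ => ρ.filter fun p => p.2 < b₀ + k, fun ρ => Finset.filter_subset _ _,
        fun ρ ρ' h => Finset.filter_subset_filter _ h, fun ρ hρ => filter_mem_towers hρ⟩
    refine acyclic_orderChains_of_carriers (ih fun j hj => h j (by omega))
      (fun c => {ρ' | ρ' ∈ towers d b₀ k L ∧ ∃ ρ ∈ c, res ρ ⊆ ρ'})
      (fun c => {ρ | ρ ∈ towers d b₀ (k + 1) L ∧ ∃ ρ' ∈ c, ρ' ⊆ ρ})
      (fun c => {ρ' | ρ' ∈ towers d b₀ (k + 1) L ∧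
        ∃ ρ ∈ c, res ρ ⊆ ρ'})
      (fun c σ hσ => hσ.1)
      (fun c c' hcc σ hσ => ⟨hσ.1, hσ.2.imp fun ρ hρ => ⟨hcc hρ.1, hρ.2⟩⟩)
      (fun c hc hne => ?_)
      (fun c σ hσ => hσ.1)
      (fun c c' hcc σ hσ => ⟨hσ.1, hσ.2.imp fun ρ hρ => ⟨hcc hρ.1, hρ.2⟩⟩)
      (fun c hc hne => ?_)
      (fun c σ hσ => hσ.1)
      (fun c c' hcc σ hσ => ⟨hσ.1, hσ.2.imp fun ρ hρ => ⟨hcc hρ.1, hρ.2⟩⟩)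
      (fun c hc hne => ?_)
      (fun c hc x hx => ⟨hc.1 x hx, x, hx, hsub x⟩)
      (fun c hc t ht σ hσ => ?_)
    · obtain ⟨m, hm, hmin⟩ := exists_min_of_mem_orderChains hc hne
      refine acyclic_orderChains_of_center (M := res m)
        ⟨hmem _ (hc.1 m hm), m, hm, subset_rfl⟩ fun x hx => Or.inr ?_
      obtain ⟨ρ, hρ, h1⟩ := hx.2
      exact (hmono (hmin ρ hρ)).trans h1
    · obtain ⟨m, hm, hmin⟩ := exists_min_of_mem_orderChains hc hne
      have e : {ρ | ρ ∈ towers d b₀ (k + 1) L ∧ ∃ ρ' ∈ c, ρ' ⊆ ρ} =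
          {ρ | ρ ∈ towers d b₀ (k + 1) L ∧ m ⊆ ρ} := by
        ext ρ
        constructor
        · rintro ⟨h1, ρ', h2, h3⟩
          exact ⟨h1, (hmin ρ' h2).trans h3⟩
        · rintro ⟨h1, h2⟩
          exact ⟨h1, m, hm, h2⟩
      rw [e]
      exact hab m (hc.1 m hm)
    · obtain ⟨m, hm, hmin⟩ := exists_min_of_mem_orderChains hc hne
      have e : {ρ' | ρ' ∈ towers d b₀ (k + 1) L ∧
          ∃ ρ ∈ c, res ρ ⊆ ρ'} =
          {ρ | ρ ∈ towers d b₀ (k + 1) L ∧ res m ⊆ ρ} := by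
        ext ρ
        constructor
        · rintro ⟨h1, ρ', h2, h3⟩
          exact ⟨h1, (hmono (hmin ρ' h2)).trans h3⟩
        · rintro ⟨h1, h2⟩
          exact ⟨h1, m, hm, h2⟩
      rw [e]
      exact hab _ (hmem m (hc.1 m hm))
    · obtain ⟨ρ', hρ', h1⟩ := hσ.2
      obtain ⟨ρ, hρ, h2⟩ := (ht.1 ρ' hρ').2
      exact ⟨hσ.1, ρ, hρ, h2.trans h1⟩

end Towers

namespace ModTwoChain

variable {T T' : Type*}

theorem exists_of_ext_apply_ne_zero {F : Finset T → ModTwoChain T'} {c : ModTwoChain T}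
    {s : Finset T'} (h : ext F c s ≠ 0) : ∃ t, c t ≠ 0 ∧ F t s ≠ 0 := by
  rw [ext, Finsupp.linearCombination_apply, Finsupp.sum, Finsupp.finsetSum_apply] at h
  obtain ⟨t, ht, h1⟩ := Finset.exists_ne_zero_of_sum_ne_zero h
  refine ⟨t, Finsupp.mem_support_iff.1 ht, fun h2 => h1 ?_⟩
  rw [Finsupp.smul_apply, h2, smul_zero]

variable [DecidableEq T] [DecidableEq T']

theorem bd_map {g : T → T'} (hg : Function.Injective g) (c : ModTwoChain T) :
    bd (ext (fun s => of (s.image g)) c) = ext (fun s => of (s.image g)) (bd c) := by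
  refine eq_on_supp (K := Set.univ) (A := bd ∘ₗ ext fun s => of (s.image g))
    (B := ext (fun s => of (s.image g)) ∘ₗ bd) (fun s _ => ?_) (by simp [supp])
  change bd (ext (fun s => of (s.image g)) (of s)) = ext (fun s => of (s.image g)) (bd (of s))
  rw [ext_of, ext_bd_of, bd_of, Finset.sum_image fun x _ y _ h => hg h]
  exact Finset.sum_congr rfl fun v _ => by rw [Finset.image_erase hg]

end ModTwoChain

section DescendingFamily

variable {V : Type*} {d : V → V → ℕ}

/-- Successive approximations, from above, to the largest family of subsets of the sets `D a`
whose members are contained in the `1`-neighbourhoods of the next `n` members. -/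
def descendingApprox (d : V → V → ℕ) (D : ℤ → Set V) (n : ℕ) : ℕ → ℤ → Set V
  | 0, _ => Set.univ
  | r + 1, a => D a ∩ thickeningInter d (fun j => descendingApprox d D n (r - j) (a + 1 + j)) n

variable {D A : ℤ → Set V} {n m : ℕ} {h : V ≃ V}

theorem descendingApprox_succ (r : ℕ) (a : ℤ) : descendingApprox d D n (r + 1) a =
    D a ∩ thickeningInter d (fun j => descendingApprox d D n (r - j) (a + 1 + j)) n := by
  rw [descendingApprox]

theorem thickening_mono {Y Z : Set V} (h : Y ⊆ Z) : thickening d Y ⊆ thickening d Z :=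
  fun _ ⟨p, hp, h1⟩ => ⟨p, h hp, h1⟩

theorem IsSDMetric.isDescending_descendingApprox (hd : IsSDMetric d)
    (hD : ∀ a, MetricConvex d (D a)) (r : ℕ) :
    ∀ a, IsDescending d (descendingApprox d D n r a) := by
  induction r using Nat.strong_induction_on with
  | _ r ih =>
  intro a
  rcases r with _ | r
  · rw [descendingApprox]
    exact hd.isDescending_univ
  · rw [descendingApprox_succ, Set.inter_comm]
    refine hd.isDescending_inter (hd.isDescending_thickeningInter (fun j _ => ih _ (by omega) _)
      fun i j hij hjn => ?_) (hD a)
    rcases hri : r - i with _ | s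
    · have : r - j = 0 := by omega
      rw [this]
      intro x _
      exact ⟨x, by rw [descendingApprox]; trivial, by simp [hd.self_eq]⟩
    · intro x hx
      rw [descendingApprox_succ] at hx
      have := hx.2 (j - i - 1) (by omega)
      have e1 : s - (j - i - 1) = r - j := by omega
      have e2 : a + 1 + (i : ℤ) + 1 + ((j - i - 1 : ℕ) : ℤ) = a + 1 + j := by omega
      simp only [e1, e2] at this
      exact this

theorem descendingApprox_succ_subset (r : ℕ) :
    ∀ a, descendingApprox d D n (r + 1) a ⊆ descendingApprox d D n r a := by
  induction r using Nat.strong_induction_on with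
  | _ r ih =>
  intro a
  rcases r with _ | r
  · rw [descendingApprox.eq_1]
    exact Set.subset_univ _
  · rw [descendingApprox_succ, descendingApprox_succ]
    refine Set.inter_subset_inter_right _ fun x hx j hj => ?_
    rcases Nat.lt_or_ge r j with hrj | hrj
    · have := hx j hj
      have e1 : r + 1 - j = r - j := by omega
      simp only [e1] at this
      exact this
    · have := hx j hj
      have e1 : r + 1 - j = r - j + 1 := by omega
      simp only [e1] at this
      exact thickening_mono (ih _ (by omega) _) this

theorem descendingApprox_antitone (a : ℤ) : Antitone fun r => descendingApprox d D n r a :=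
  antitone_nat_of_succ_le fun r => descendingApprox_succ_subset r a

theorem subset_descendingApprox (hAD : ∀ a, A a ⊆ D a)
    (hA : ∀ a, ∀ j : ℕ, j < n → A a ⊆ thickening d (A (a + 1 + j))) (r : ℕ) :
    ∀ a, A a ⊆ descendingApprox d D n r a := by
  induction r using Nat.strong_induction_on with
  | _ r ih =>
  intro a
  rcases r with _ | r
  · rw [descendingApprox]
    exact Set.subset_univ _
  · rw [descendingApprox_succ]
    exact fun x hx => ⟨hAD a hx, fun j hj => thickening_mono (ih _ (by omega) _) (hA a j hj hx)⟩

theorem mem_thickening_map (hh : ∀ u v, d (h u) (h v) = d u v) {Y Z : Set V}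
    (hYZ : ∀ u, u ∈ Y ↔ h u ∈ Z) (u : V) : u ∈ thickening d Y ↔ h u ∈ thickening d Z := by
  constructor
  · rintro ⟨p, hp, h1⟩
    exact ⟨h p, (hYZ p).1 hp, by rwa [hh]⟩
  · rintro ⟨p, hp, h1⟩
    obtain ⟨p, rfl⟩ := h.surjective p
    exact ⟨p, (hYZ p).2 hp, by rwa [hh] at h1⟩

theorem mem_descendingApprox_map (hh : ∀ u v, d (h u) (h v) = d u v)
    (hDh : ∀ a u, u ∈ D a ↔ h u ∈ D (a + m)) (r : ℕ) :
    ∀ a u, u ∈ descendingApprox d D n r a ↔ h u ∈ descendingApprox d D n r (a + m) := by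
  induction r using Nat.strong_induction_on with
  | _ r ih =>
  intro a u
  rcases r with _ | r
  · rw [descendingApprox, descendingApprox]
    simp
  · rw [descendingApprox_succ, descendingApprox_succ]
    refine and_congr (hDh a u) (forall₂_congr fun j _ => mem_thickening_map hh (fun v => ?_) u)
    have := ih (r - j) (by omega) (a + 1 + j) v
    rw [this]
    have e : a + 1 + (j : ℤ) + m = a + m + 1 + j := by ring
    rw [e]

/-- A family of nonempty descending sets which is contained in the `1`-neighbourhoods of its
translates. -/
theorem IsSDMetric.exists_descending_family (hd : IsSDMetric d)
    (hh : ∀ u v, d (h u) (h v) = d u v) (hDfin : ∀ a, (D a).Finite)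
    (hD : ∀ a, MetricConvex d (D a)) (hDh : ∀ a u, u ∈ D a ↔ h u ∈ D (a + m))
    (hAD : ∀ a, A a ⊆ D a) (hAne : ∀ a, (A a).Nonempty)
    (hA : ∀ a, ∀ j : ℕ, j < n → A a ⊆ thickening d (A (a + 1 + j))) :
    ∃ K : ℤ → Set V, (∀ a, IsDescending d (K a)) ∧ (∀ a, (K a).Nonempty) ∧ (∀ a, K a ⊆ D a) ∧
      (∀ a, ∀ j : ℕ, j < n → K a ⊆ thickening d (K (a + 1 + j))) ∧
      ∀ a u, u ∈ K a ↔ h u ∈ K (a + m) := by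
  let K : ℤ → Set V := fun a => {u | ∀ r, u ∈ descendingApprox d D n r a}
  have hstab : ∀ a, ∃ r, K a = descendingApprox d D n r a := by
    intro a
    have h1 : ∀ u, ∃ r, u ∈ descendingApprox d D n r a → u ∈ K a := by
      intro u
      by_cases hu : u ∈ K a
      · exact ⟨0, fun _ => hu⟩
      · obtain ⟨r, hr⟩ := not_forall.1 hu
        exact ⟨r, fun h => absurd h hr⟩
    choose r hr using h1
    obtain ⟨B, hB⟩ := ((hDfin a).image r).bddAbove
    refine ⟨B + 1, Set.Subset.antisymm (fun u hu => hu _) fun u hu => hr u ?_⟩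
    have hu' := hu
    rw [descendingApprox_succ] at hu'
    exact descendingApprox_antitone a ((hB (Set.mem_image_of_mem r hu'.1)).trans
      (Nat.le_succ B)) hu
  refine ⟨K, fun a => ?_, fun a => ?_, fun a u hu => ?_, fun a j hj u hu => ?_, fun a u => ?_⟩
  · obtain ⟨r, hr⟩ := hstab a
    rw [hr]
    exact hd.isDescending_descendingApprox hD r a
  · exact (hAne a).mono fun u hu r => subset_descendingApprox hAD hA r a hu
  · have := hu 1
    rw [descendingApprox_succ] at this
    exact this.1
  · obtain ⟨r, hr⟩ := hstab (a + 1 + j)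
    have := hu (r + j + 1)
    rw [descendingApprox_succ] at this
    have h1 := this.2 j hj
    rw [hr]
    simpa using h1
  · exact forall_congr' fun r => mem_descendingApprox_map hh hDh r a u

end DescendingFamily

section TowerDynamics

variable {V : Type*} {d : V → V → ℕ} {K : ℤ → Set V} {n m : ℕ} {h : V ≃ V}

/-- The towers over `[a + 1, a + 1 + n)` which continue a chain of towers over `[a, a + n)`. -/
def nextTowers (d : V → V → ℕ) (K : ℤ → Set V) (n : ℕ) (a : ℤ) (c : Finset (Finset (V × ℤ))) :
    Set (Finset (V × ℤ)) :=
  {ρ' | ρ' ∈ towers d (a + 1) n K ∧ (∃ ρ ∈ c, ∀ p ∈ ρ', p.2 ≠ a + n → p ∈ ρ) ∧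
    ∃ ρ ∈ c, ∀ p ∈ ρ', p.2 = a + n → ∀ q ∈ ρ, d q.1 p.1 ≤ 1}

theorem nextTowers_mono (a : ℤ) : Monotone (nextTowers d K n a) := fun _ _ hcc _ hρ =>
  ⟨hρ.1, hρ.2.1.imp fun _ h => ⟨hcc h.1, h.2⟩, hρ.2.2.imp fun _ h => ⟨hcc h.1, h.2⟩⟩

/-- The action of `h` on labelled points, shifting the labels by `m`. -/
def labelShift (h : V ≃ V) (m : ℕ) : V × ℤ ≃ V × ℤ := h.prodCongr (Equiv.addRight (m : ℤ))

theorem labelShift_apply (p : V × ℤ) : labelShift h m p = (h p.1, p.2 + m) := rfl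

variable [DecidableEq V]

theorem IsSDMetric.acyclic_extensions (hd : IsSDMetric d) {Y : Set V} (hY : IsDescending d Y)
    (hne : Y.Nonempty) (hfin : Y.Finite) (ρ : Finset (V × ℤ))
    (hρ : ∀ p ∈ ρ, ∀ q ∈ ρ, d p.1 q.1 ≤ 1) (hρY : ∀ p ∈ ρ, p.1 ∈ thickening d Y) :
    Acyclic (orderChains (cliques d {x | x ∈ Y ∧ ∀ p ∈ ρ, d p.1 x ≤ 1})) := by
  have e : {x | x ∈ Y ∧ ∀ p ∈ ρ, d p.1 x ≤ 1} =
      Y ∩ {x | ∀ v ∈ {v : V | ∃ p ∈ ρ, p.1 = v}, d v x ≤ 1} := by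
    ext x
    constructor
    · rintro ⟨h1, h2⟩
      refine ⟨h1, ?_⟩
      rintro _ ⟨p, hp, rfl⟩
      exact h2 p hp
    · rintro ⟨h1, h2⟩
      exact ⟨h1, fun p hp => h2 p.1 ⟨p, hp, rfl⟩⟩
  obtain ⟨y, hy, hy2⟩ := hd.exists_common_of_subset_thickening hY hne (ρ.image Prod.fst)
    (by
      intro x hx y hy
      obtain ⟨p, hp, rfl⟩ := Finset.mem_image.1 hx
      obtain ⟨q, hq, rfl⟩ := Finset.mem_image.1 hy
      exact hρ p hp q hq)
    (by
      intro x hx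
      obtain ⟨p, hp, rfl⟩ := Finset.mem_image.1 hx
      exact hρY p hp)
  have hdesc := hd.isDescending_inter hY
    (hd.metricConvex_commonNeighbors {v : V | ∃ p ∈ ρ, p.1 = v})
  rw [← e] at hdesc
  exact hd.acyclic_cliques hdesc
    ⟨y, hy, fun p hp => hy2 p.1 (Finset.mem_image_of_mem _ hp)⟩ (hfin.subset fun x hx => hx.1)

theorem IsSDMetric.acyclic_towers_of_descending (hd : IsSDMetric d)
    (hK : ∀ a, IsDescending d (K a)) (hne : ∀ a, (K a).Nonempty) (hfin : ∀ a, (K a).Finite)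
    (hKK : ∀ a, ∀ j : ℕ, j < n → K a ⊆ thickening d (K (a + 1 + j))) (a : ℤ) :
    Acyclic (orderChains (towers d a n K)) := by
  refine hd.acyclic_towers a K n fun k hk ρ hρ =>
    hd.acyclic_extensions (hK _) (hne _) (hfin _) ρ hρ.2.2 fun p hp => ?_
  obtain ⟨h1, h2, h3⟩ := hρ.1 p hp
  have := hKK p.2 (a + k - p.2 - 1).toNat (by omega) h3
  have e : p.2 + 1 + ((a + k - p.2 - 1).toNat : ℤ) = a + k := by omega
  rwa [e] at this

theorem IsSDMetric.acyclic_nextTowers (hd : IsSDMetric d)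
    (hK : ∀ a, IsDescending d (K a)) (hne : ∀ a, (K a).Nonempty) (hfin : ∀ a, (K a).Finite)
    (hKK : ∀ a, ∀ j : ℕ, j < n → K a ⊆ thickening d (K (a + 1 + j))) {a : ℤ}
    {c : Finset (Finset (V × ℤ))} (hc : c ∈ orderChains (towers d a n K)) (hcne : c.Nonempty) :
    Acyclic (orderChains (nextTowers d K n a c)) := by
  obtain ⟨M, hM, hmax⟩ := exists_max_of_mem_orderChains hc hcne
  obtain ⟨m, hm, hmin⟩ := exists_min_of_mem_orderChains hc hcne
  have hMT := hc.1 M hM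
  set L : ℤ → Set V := fun b =>
    {x | x ∈ K b ∧ (b ≠ a + n → (x, b) ∈ M) ∧ (b = a + n → ∀ q ∈ m, d q.1 x ≤ 1)} with hL
  have e : nextTowers d K n a c = towers d (a + 1) n L := by
    ext ρ
    constructor
    · rintro ⟨h1, ⟨ρ1, h2, h3⟩, ρ2, h4, h5⟩
      exact ⟨fun p hp => ⟨(h1.1 p hp).1, (h1.1 p hp).2.1, (h1.1 p hp).2.2,
        fun h => hmax ρ1 h2 (h3 p hp h), fun h q hq => h5 p hp h q (hmin ρ2 h4 hq)⟩, h1.2⟩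
    · rintro ⟨h1, h2⟩
      exact ⟨⟨fun p hp => ⟨(h1 p hp).1, (h1 p hp).2.1, (h1 p hp).2.2.1⟩, h2⟩,
        ⟨M, hM, fun p hp h => (h1 p hp).2.2.2.1 h⟩, m, hm, fun p hp h => (h1 p hp).2.2.2.2 h⟩
  rw [e]
  refine hd.acyclic_towers (a + 1) L n fun k hk ρ hρ => ?_
  have hρM : ρ ⊆ M := fun p hp => (hρ.1 p hp).2.2.2.1 (by have := (hρ.1 p hp).2.1; omega)
  by_cases hkn : k + 1 = n
  · have hb : a + 1 + (k : ℤ) = a + n := by omega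
    have hsub : ρ ∪ m ⊆ M := Finset.union_subset hρM (hmin M hM)
    have := hd.acyclic_extensions (hK (a + n)) (hne _) (hfin _) (ρ ∪ m)
      (fun p hp q hq => hMT.2.2 p (hsub hp) q (hsub hq)) (fun p hp => by
        obtain ⟨h1, h2, h3⟩ := hMT.1 p (hsub hp)
        have := hKK p.2 (a + n - p.2 - 1).toNat (by omega) h3
        have e : p.2 + 1 + ((a + n - p.2 - 1).toNat : ℤ) = a + n := by omega
        rwa [e] at this)
    convert this using 4
    ext x
    rw [hb]
    constructor
    · rintro ⟨⟨h1, -, h2⟩, h3⟩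
      refine ⟨h1, fun p hp => ?_⟩
      rcases Finset.mem_union.1 hp with hp | hp
      · exact h3 p hp
      · exact h2 rfl p hp
    · rintro ⟨h1, h2⟩
      exact ⟨⟨h1, fun h => absurd rfl h, fun _ q hq => h2 q (Finset.mem_union_right _ hq)⟩,
        fun p hp => h2 p (Finset.mem_union_left _ hp)⟩
  · have hb : a + 1 + (k : ℤ) ≠ a + n := by omega
    obtain ⟨x, hx⟩ := hMT.2.1 (a + 1 + k) (by omega) (by omega)
    refine hd.acyclic_cliques_of_cone (e := x)
      ⟨⟨(hMT.1 _ hx).2.2, fun _ => hx, fun h => absurd h hb⟩,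
        fun p hp => hMT.2.2 p (hρM hp) _ hx⟩ fun y hy => ?_
    exact hMT.2.2 _ hx _ (hy.1.2.1 hb)

/-- The action of `h` on families of towers. -/
def towerShift (h : V ≃ V) (m : ℕ) (c : Finset (Finset (V × ℤ))) : Finset (Finset (V × ℤ)) :=
  c.image (Finset.image (labelShift h m))

theorem mem_towers_shift (hh : ∀ u v, d (h u) (h v) = d u v)
    (hKh : ∀ a u, u ∈ K a ↔ h u ∈ K (a + m)) {a : ℤ} {ρ : Finset (V × ℤ)} :
    ρ ∈ towers d a n K ↔ ρ.image (labelShift h m) ∈ towers d (a + m) n K := by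
  constructor
  · rintro ⟨h1, h2, h3⟩
    refine ⟨fun p hp => ?_, fun b hb hb' => ?_, fun p hp q hq => ?_⟩
    · obtain ⟨p, hp', rfl⟩ := Finset.mem_image.1 hp
      obtain ⟨h4, h5, h6⟩ := h1 p hp'
      exact ⟨by simp only [labelShift_apply]; omega, by simp only [labelShift_apply]; omega,
        (hKh _ _).1 h6⟩
    · obtain ⟨x, hx⟩ := h2 (b - m) (by omega) (by omega)
      exact ⟨h x, Finset.mem_image.2 ⟨_, hx, by simp [labelShift_apply]⟩⟩
    · obtain ⟨p, hp', rfl⟩ := Finset.mem_image.1 hp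
      obtain ⟨q, hq', rfl⟩ := Finset.mem_image.1 hq
      simpa [labelShift_apply, hh] using h3 p hp' q hq'
  · rintro ⟨h1, h2, h3⟩
    refine ⟨fun p hp => ?_, fun b hb hb' => ?_, fun p hp q hq => ?_⟩
    · obtain ⟨h4, h5, h6⟩ := h1 _ (Finset.mem_image_of_mem _ hp)
      simp only [labelShift_apply] at h4 h5 h6
      exact ⟨by omega, by omega, (hKh _ _).2 h6⟩
    · obtain ⟨x, hx⟩ := h2 (b + m) (by omega) (by omega)
      obtain ⟨⟨y, b'⟩, hp, e⟩ := Finset.mem_image.1 hx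
      have e2 : b' = b := by
        have := congrArg Prod.snd e
        simp only [labelShift_apply] at this
        omega
      exact ⟨y, e2 ▸ hp⟩
    · have := h3 _ (Finset.mem_image_of_mem _ hp) _ (Finset.mem_image_of_mem _ hq)
      simpa [labelShift_apply, hh] using this

theorem orderChains_shift {U W : Set (Finset (V × ℤ))}
    (hUW : ∀ ρ, ρ ∈ U → ρ.image (labelShift h m) ∈ W) {c : Finset (Finset (V × ℤ))}
    (hc : c ∈ orderChains U) : towerShift h m c ∈ orderChains W := by
  refine ⟨fun x hx => ?_, fun x hx y hy => ?_⟩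
  · obtain ⟨x, hx', rfl⟩ := Finset.mem_image.1 hx
    exact hUW x (hc.1 x hx')
  · obtain ⟨x, hx', rfl⟩ := Finset.mem_image.1 hx
    obtain ⟨y, hy', rfl⟩ := Finset.mem_image.1 hy
    exact (hc.2 x hx' y hy').imp (Finset.image_subset_image ·) (Finset.image_subset_image ·)

theorem mem_nextTowers_shift (hh : ∀ u v, d (h u) (h v) = d u v)
    (hKh : ∀ a u, u ∈ K a ↔ h u ∈ K (a + m)) {a : ℤ} {c : Finset (Finset (V × ℤ))}
    {ρ : Finset (V × ℤ)} (hρ : ρ ∈ nextTowers d K n a c) :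
    ρ.image (labelShift h m) ∈ nextTowers d K n (a + m) (towerShift h m c) := by
  obtain ⟨h1, ⟨ρ1, h2, h3⟩, ρ2, h4, h5⟩ := hρ
  refine ⟨?_, ⟨_, Finset.mem_image_of_mem _ h2, fun p hp hne => ?_⟩,
    _, Finset.mem_image_of_mem _ h4, fun p hp he q hq => ?_⟩
  · have := (mem_towers_shift hh hKh).1 h1
    rwa [add_right_comm] at this
  · obtain ⟨p, hp', rfl⟩ := Finset.mem_image.1 hp
    simp only [labelShift_apply] at hne
    exact Finset.mem_image_of_mem _ (h3 p hp' (by omega))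
  · obtain ⟨p, hp', rfl⟩ := Finset.mem_image.1 hp
    obtain ⟨q, hq', rfl⟩ := Finset.mem_image.1 hq
    simp only [labelShift_apply] at he ⊢
    rw [hh]
    exact h5 p hp' (by omega) q hq'

end TowerDynamics

section TowerDynamics

variable {V : Type*} {d : V → V → ℕ} {K : ℤ → Set V} {n m : ℕ} {h : V ≃ V}

theorem finite_towers (hfin : ∀ a, (K a).Finite) (a : ℤ) : (towers d a n K).Finite := by
  have hS : (⋃ b ∈ Set.Ico a (a + n), K b ×ˢ {b}).Finite :=
    (Set.finite_Ico _ _).biUnion fun b _ => (hfin b).prod (Set.finite_singleton b)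
  refine (hS.toFinset.powerset.finite_toSet).subset fun ρ hρ => ?_
  rw [Finset.mem_coe, Finset.mem_powerset]
  intro p hp
  obtain ⟨h1, h2, h3⟩ := hρ.1 p hp
  rw [Set.Finite.mem_toFinset]
  exact Set.mem_biUnion (x := p.2) ⟨h1, h2⟩ ⟨h3, rfl⟩

theorem finite_orderChains {α : Type*} {U : Set (Finset α)} (hU : U.Finite) :
    (orderChains U).Finite := by
  refine (hU.toFinset.powerset.finite_toSet).subset fun c hc => ?_
  rw [Finset.mem_coe, Finset.mem_powerset]
  exact fun x hx => hU.mem_toFinset.2 (hc.1 x hx)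

theorem nextTowers_subset (a : ℤ) (c : Finset (Finset (V × ℤ))) :
    nextTowers d K n a c ⊆ towers d (a + 1) n K := fun _ hρ => hρ.1

variable [DecidableEq V]

theorem IsSDMetric.exists_tower_sequence (hd : IsSDMetric d)
    (hh : ∀ u v, d (h u) (h v) = d u v)
    (hK : ∀ a, IsDescending d (K a)) (hne : ∀ a, (K a).Nonempty) (hfin : ∀ a, (K a).Finite)
    (hKK : ∀ a, ∀ j : ℕ, j < n → K a ⊆ thickening d (K (a + 1 + j)))
    (hKh : ∀ a u, u ∈ K a ↔ h u ∈ K (a + m)) :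
    ∃ c : ℕ → Finset (Finset (V × ℤ)), (∀ i < m, c i ∈ orderChains (towers d i n K) ∧
      (c i).Nonempty ∧ c (i + 1) ∈ orderChains (nextTowers d K n i (c i))) ∧
      c m = towerShift h m (c 0) := by
  have hF : ∀ i : ℕ, ∃ F : Finset (Finset (V × ℤ)) → ModTwoChain (Finset (V × ℤ)),
      F ∅ = of ∅ ∧ (∀ s ∈ orderChains (towers d i n K),
        F s ∈ supp (orderChains (nextTowers d K n i s))) ∧
      ∀ z ∈ supp (orderChains (towers d i n K)), bd (ext F z) = ext F (bd z) := fun i =>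
    exists_chainMap (downClosed_orderChains _) (fun s => orderChains (nextTowers d K n i s))
      (fun _ _ _ _ => orderChains_mono (nextTowers_mono _ (Finset.erase_subset _ _)))
      (fun s hs hsne => hd.acyclic_nextTowers hK hne hfin hKK hs hsne)
      (empty_mem_orderChains _)
  choose F hF0 hF1 hF2 using hF
  let A : ℕ → (ModTwoChain (Finset (V × ℤ)) →ₗ[ZMod 2] ModTwoChain (Finset (V × ℤ))) :=
    fun i => Nat.rec LinearMap.id (fun j B => ext (F j) ∘ₗ B) i
  have hA_succ : ∀ i z, A (i + 1) z = ext (F i) (A i z) := fun _ _ => rfl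
  have hA_supp : ∀ i : ℕ, ∀ z ∈ supp (orderChains (towers d 0 n K)),
      A i z ∈ supp (orderChains (towers d i n K)) := by
    intro i
    induction i with
    | zero => exact fun z hz => hz
    | succ i ih =>
      intro z hz
      rw [hA_succ]
      refine ext_mem_supp (fun s hs => supp_mono (orderChains_mono ?_) (hF1 i s hs)) (ih z hz)
      simpa using nextTowers_subset (d := d) (K := K) (n := n) i s
  have hA_bd : ∀ i : ℕ, ∀ z ∈ supp (orderChains (towers d 0 n K)),
      bd (A i z) = A i (bd z) := by
    intro i
    induction i with
    | zero => exact fun z _ => rfl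
    | succ i ih =>
      intro z hz
      rw [hA_succ, hA_succ, hF2 i _ (hA_supp i z hz), ih z hz]
  have hA_empty : ∀ i, A i (of ∅) = of ∅ := by
    intro i
    induction i with
    | zero => rfl
    | succ i ih => rw [hA_succ, ih, ext_of, hF0]
  let g : Finset (V × ℤ) → Finset (V × ℤ) := Finset.image (labelShift h m).symm
  have hg : Function.Injective g := Finset.image_injective (labelShift h m).symm.injective
  have hgl : ∀ ρ, (g ρ).image (labelShift h m) = ρ := fun ρ => by
    simp [g, Finset.image_image]
  have hgc : ∀ s ∈ orderChains (towers d m n K), s.image g ∈ orderChains (towers d 0 n K) := by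
    intro s hs
    refine ⟨fun x hx => ?_, fun x hx y hy => ?_⟩
    · obtain ⟨x, hx', rfl⟩ := Finset.mem_image.1 hx
      rw [mem_towers_shift hh hKh, hgl, zero_add]
      exact hs.1 x hx'
    · obtain ⟨x, hx', rfl⟩ := Finset.mem_image.1 hx
      obtain ⟨y, hy', rfl⟩ := Finset.mem_image.1 hy
      exact (hs.2 x hx' y hy').imp (Finset.image_subset_image ·) (Finset.image_subset_image ·)
  obtain ⟨c, hc, hcne, hcc⟩ := exists_mem_of_acyclic
    (finite_orderChains (finite_towers (d := d) (n := n) hfin 0)) (downClosed_orderChains _)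
    (hd.acyclic_towers_of_descending hK hne hfin hKK 0) (empty_mem_orderChains _)
    (ext (fun s => of (s.image g)) ∘ₗ A m)
    (fun z hz => ext_mem_supp (F := fun s => of (s.image g))
      (fun s hs => of_mem_supp (hgc s hs)) (hA_supp m z hz))
    (fun z hz => by
      rw [LinearMap.comp_apply, LinearMap.comp_apply, bd_map hg, hA_bd m z hz])
    (by rw [LinearMap.comp_apply, hA_empty, ext_of, Finset.image_empty])
  obtain ⟨t, ht, htc⟩ := exists_of_ext_apply_ne_zero hcc
  have htc : c = t.image g := by
    by_contra hne
    exact htc (Finsupp.single_eq_of_ne hne)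
  have hct : t = towerShift h m c := by
    rw [htc, towerShift, Finset.image_image]
    conv_lhs => rw [← Finset.image_id (s := t)]
    exact congrArg (fun f => t.image f) (funext fun ρ => (hgl ρ).symm)
  have hseq : ∀ (i : ℕ) (s : Finset (Finset (V × ℤ))), A i (of c) s ≠ 0 →
      ∃ u : ℕ → Finset (Finset (V × ℤ)), u 0 = c ∧ u i = s ∧ ∀ j < i,
        u j ∈ orderChains (towers d j n K) ∧
        u (j + 1) ∈ orderChains (nextTowers d K n j (u j)) := by
    intro i
    induction i with
    | zero =>
      intro s hs
      refine ⟨fun _ => c, rfl, ?_, fun j hj => absurd hj (Nat.not_lt_zero j)⟩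
      by_contra hne
      exact hs (Finsupp.single_eq_of_ne fun e => hne e.symm)
    | succ i ih =>
      intro s hs
      rw [hA_succ] at hs
      obtain ⟨r, hr, hrs⟩ := exists_of_ext_apply_ne_zero hs
      have hmem : r ∈ orderChains (towers d i n K) :=
        (Finsupp.mem_supported _ _).1 (hA_supp i _ (of_mem_supp hc))
          (Finsupp.mem_support_iff.2 hr)
      obtain ⟨u, h1, h2, h3⟩ := ih r hr
      have hsm : s ∈ orderChains (nextTowers d K n i r) :=
        (Finsupp.mem_supported _ _).1 (hF1 i r hmem) (Finsupp.mem_support_iff.2 hrs)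
      refine ⟨Function.update u (i + 1) s, ?_, Function.update_self _ _ _, fun j hj => ?_⟩
      · rw [Function.update_of_ne (by omega), h1]
      · rw [Function.update_of_ne (by omega)]
        rcases Nat.lt_succ_iff_lt_or_eq.1 hj with hj | rfl
        · rw [Function.update_of_ne (by omega)]
          exact h3 j hj
        · rw [Function.update_self, h2]
          exact ⟨hmem, hsm⟩
  obtain ⟨u, h1, h2, h3⟩ := hseq m t ht
  refine ⟨u, fun i hi => ⟨(h3 i hi).1, ?_, (h3 i hi).2⟩, by rw [h1, h2, hct]⟩
  rw [Finset.nonempty_iff_ne_empty]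
  intro hempty
  have key : ∀ j, i ≤ j → j ≤ m → u j = ∅ := by
    intro j hij
    induction j, hij using Nat.le_induction with
    | base => exact fun _ => hempty
    | succ j _ ih =>
      intro hjm
      have h4 := (h3 j (by omega)).2
      rw [ih (by omega)] at h4
      refine Finset.eq_empty_of_forall_notMem fun x hx => ?_
      obtain ⟨-, ⟨ρ, hρ, -⟩, -⟩ := h4.1 x hx
      exact absurd hρ (Finset.notMem_empty ρ)
  have := key m hi.le le_rfl
  rw [h2, hct, towerShift, Finset.image_eq_empty] at this
  exact hcne.ne_empty this

/-- A sequence of `m` steps that closes up after applying a transformation extends to an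
equivariant infinite sequence. -/
theorem exists_periodic_extension {T : Type*} (S : T → T) (hm : 1 ≤ m) (R : ℕ → T → T → Prop)
    (hR : ∀ a s t, R a s t → R (a + m) (S s) (S t)) (c : ℕ → T)
    (hc : ∀ i < m, R i (c i) (c (i + 1))) (hcm : c m = S (c 0)) :
    ∃ e : ℕ → T, (∀ a, e (a + m) = S (e a)) ∧ ∀ a, R a (e a) (e (a + 1)) := by
  let e : ℕ → T := fun a => S^[a / m] (c (a % m))
  have he : ∀ a, e (a + m) = S (e a) := fun a => by
    simp only [e]
    rw [Nat.add_div_right _ hm, Nat.add_mod_right, Function.iterate_succ_apply']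
  have hlt : ∀ a < m, e a = c a := fun a ha => by
    simp [e, Nat.div_eq_of_lt ha, Nat.mod_eq_of_lt ha]
  refine ⟨e, he, fun a => ?_⟩
  induction a using Nat.strong_induction_on with
  | _ a ih =>
  rcases Nat.lt_or_ge a m with ha | ha
  · have h1 : e (a + 1) = c (a + 1) := by
      rcases Nat.lt_or_ge (a + 1) m with ha' | ha'
      · exact hlt _ ha'
      · have : a + 1 = 0 + m := by omega
        rw [this, he, hlt 0 (by omega), zero_add, hcm]
    rw [hlt a ha, h1]
    exact hc a ha
  · obtain ⟨b, rfl⟩ := Nat.exists_eq_add_of_le' ha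
    have := hR _ _ _ (ih b (by omega))
    rw [← he, ← he] at this
    rwa [add_right_comm]

/-- A family of finite sets, each of which is contained in the `1`-neighbourhoods of the next
`n` sets, gives rise to an equivariant sequence of points in which points with indices differing
by at most `n` are adjacent. -/
theorem IsSDMetric.exists_equivariant_sequence (hd : IsSDMetric d)
    (hh : ∀ u v, d (h u) (h v) = d u v) (hn : 1 ≤ n) (hm : 1 ≤ m) {D A : ℤ → Set V}
    (hDfin : ∀ a, (D a).Finite) (hD : ∀ a, MetricConvex d (D a))
    (hDh : ∀ a u, u ∈ D a ↔ h u ∈ D (a + m))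
    (hAD : ∀ a, A a ⊆ D a) (hAne : ∀ a, (A a).Nonempty)
    (hA : ∀ a, ∀ j : ℕ, j < n → A a ⊆ thickening d (A (a + 1 + j))) :
    ∃ f : ℤ → V, (∀ a, f (a + m) = h (f a)) ∧ (∀ a, f a ∈ D a) ∧
      ∀ a b : ℤ, |a - b| ≤ n → d (f a) (f b) ≤ 1 := by
  obtain ⟨K, hK, hne, hKD, hKK, hKh⟩ := hd.exists_descending_family hh hDfin hD hDh hAD hAne hA
  have hfin : ∀ a, (K a).Finite := fun a => (hDfin a).subset (hKD a)
  obtain ⟨c, hc, hcm⟩ := hd.exists_tower_sequence hh hK hne hfin hKK hKh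
  obtain ⟨e, he, heR⟩ := exists_periodic_extension (towerShift h m) hm
    (fun a s t => s ∈ orderChains (towers d a n K) ∧ s.Nonempty ∧
      t ∈ orderChains (nextTowers d K n a s))
    (by
      rintro a s t ⟨h1, h2, h3⟩
      refine ⟨?_, h2.image _, ?_⟩
      · push_cast
        exact orderChains_shift (fun ρ hρ => (mem_towers_shift hh hKh).1 hρ) h1
      · push_cast
        exact orderChains_shift (fun ρ hρ => mem_nextTowers_shift hh hKh hρ) h3) c hc hcm
  have hN : ∀ b : ℕ, ∃ x, ∀ ρ ∈ e b, (x, (b : ℤ)) ∈ ρ := by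
    intro b
    obtain ⟨h1, h2, -⟩ := heR b
    obtain ⟨μ, hμ, hmin⟩ := exists_min_of_mem_orderChains h1 h2
    obtain ⟨x, hx⟩ := (h1.1 μ hμ).2.1 b le_rfl (by omega)
    exact ⟨x, fun ρ hρ => hmin ρ hρ hx⟩
  choose g hg using hN
  let f : ℤ → V := fun a => (h ^ (a / m) : Equiv.Perm V) (g (a % m).toNat)
  have hm0 : (m : ℤ) ≠ 0 := by omega
  have hf : ∀ a, f (a + m) = h (f a) := fun a => by
    simp only [f]
    rw [Int.add_ediv_of_dvd_right (dvd_refl _), Int.ediv_self hm0, Int.add_emod_right, add_comm,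
      zpow_add, zpow_one]
    rfl
  have hfN : ∀ b : ℕ, ∀ ρ ∈ e b, (f b, (b : ℤ)) ∈ ρ := by
    intro b
    induction b using Nat.strong_induction_on with
    | _ b ih =>
    rcases Nat.lt_or_ge b m with hb | hb
    · have h1 : f b = g b := by
        simp only [f]
        rw [Int.ediv_eq_zero_of_lt (by omega) (by omega), Int.emod_eq_of_lt (by omega) (by omega)]
        simp
      rw [h1]
      exact hg b
    · obtain ⟨b, rfl⟩ := Nat.exists_eq_add_of_le' hb
      intro ρ hρ
      rw [he] at hρ
      obtain ⟨ρ, hρ', rfl⟩ := Finset.mem_image.1 hρ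
      push_cast
      rw [hf]
      exact Finset.mem_image_of_mem (labelShift h m) (ih b (by omega) ρ hρ')
  have hdown : ∀ (a k : ℕ) (y : V) (b : ℤ), b < a + n → (∃ ρ ∈ e (a + k), (y, b) ∈ ρ) →
      ∃ ρ ∈ e a, (y, b) ∈ ρ := by
    intro a k y b hb
    induction k with
    | zero => exact id
    | succ k ih =>
      rintro ⟨ρ, hρ, hy⟩
      obtain ⟨-, ⟨ρ', h1, h2⟩, -⟩ := (heR (a + k)).2.2.1 ρ hρ
      exact ih ⟨ρ', h1, h2 _ hy (by push_cast; omega)⟩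
  have hadj : ∀ a k : ℕ, k ≤ n → d (f a) (f (a + k : ℕ)) ≤ 1 := by
    intro a k hk
    obtain ⟨ρ0, hρ0⟩ := (heR (a + k)).2.1
    have hy := hfN (a + k) ρ0 hρ0
    rcases hk.lt_or_eq with hk | rfl
    · obtain ⟨ρ, h1, h2⟩ := hdown a k _ _ (by push_cast; omega) ⟨ρ0, hρ0, hy⟩
      exact ((heR a).1.1 ρ h1).2.2 _ (hfN a ρ h1) _ h2
    · obtain ⟨ρ, h1, h2⟩ := hdown (a + 1) (k - 1) (f (a + k : ℕ)) ((a + k : ℕ) : ℤ)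
        (by push_cast; omega) ⟨ρ0, by rwa [show a + 1 + (k - 1) = a + k by omega], hy⟩
      obtain ⟨-, -, ρ', h3, h4⟩ := (heR a).2.2.1 ρ h1
      exact h4 _ h2 (by push_cast; rfl) _ (hfN a ρ' h3)
  have hshift : ∀ (k : ℕ) (a : ℤ), f (a + k * m) = (h ^ k : Equiv.Perm V) (f a) := by
    intro k a
    induction k with
    | zero => simp
    | succ k ih =>
      rw [pow_succ', Equiv.Perm.mul_apply, ← ih, ← hf]
      congr 1
      push_cast
      ring
  have hhk : ∀ (k : ℕ) (u v : V),
      d ((h ^ k : Equiv.Perm V) u) ((h ^ k : Equiv.Perm V) v) = d u v := by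
    intro k u v
    induction k with
    | zero => rfl
    | succ k ih =>
      rw [pow_succ', Equiv.Perm.mul_apply, Equiv.Perm.mul_apply, ← ih]
      exact hh _ _
  have hDk : ∀ (k : ℕ) (a : ℤ) (u : V), u ∈ D a ↔ (h ^ k : Equiv.Perm V) u ∈ D (a + k * m) := by
    intro k a u
    induction k with
    | zero => simp
    | succ k ih =>
      rw [ih, pow_succ', Equiv.Perm.mul_apply, hDh]
      push_cast
      rw [add_mul, one_mul, add_assoc]
  have hle : ∀ a : ℤ, 0 ≤ a + a.natAbs * m := by
    intro a
    have : (a.natAbs : ℤ) * 1 ≤ a.natAbs * m :=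
      mul_le_mul_of_nonneg_left (by omega) (by omega)
    omega
  refine ⟨f, hf, fun a => ?_, ?_⟩
  · rw [hDk a.natAbs, ← hshift]
    obtain ⟨b, hb⟩ := Int.eq_ofNat_of_zero_le (hle a)
    rw [hb]
    obtain ⟨ρ, hρ⟩ := (heR b).2.1
    exact hKD _ (((heR b).1.1 ρ hρ).1 _ (hfN b ρ hρ)).2.2
  · have key : ∀ a b : ℤ, a ≤ b → b - a ≤ n → d (f a) (f b) ≤ 1 := by
      intro a b hab hbn
      rw [← hhk a.natAbs, ← hshift, ← hshift]
      obtain ⟨a', ha'⟩ := Int.eq_ofNat_of_zero_le (hle a)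
      have := hadj a' (b - a).toNat (by omega)
      have e1 : b + a.natAbs * m = ((a' + (b - a).toNat : ℕ) : ℤ) := by
        rw [Nat.cast_add]; omega
      rw [e1, ha']
      exact this
    intro a b hab
    rw [abs_le] at hab
    rcases le_total a b with h1 | h1
    · exact key a b h1 (by omega)
    · rw [hd.symm]
      exact key b a h1 (by omega)

end TowerDynamics

section Isometries

variable {V : Type*} {d : V → V → ℕ} {h : Equiv.Perm V}

theorem dist_zpow (hh : ∀ u v, d (h u) (h v) = d u v) (i : ℤ) (u v : V) :
    d ((h ^ i) u) ((h ^ i) v) = d u v := by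
  induction i generalizing u v with
  | zero => rfl
  | succ i ih => rw [zpow_add_one, Equiv.Perm.mul_apply, Equiv.Perm.mul_apply, ih, hh]
  | pred i ih =>
    rw [zpow_sub_one, Equiv.Perm.mul_apply, Equiv.Perm.mul_apply, ih, ← hh]
    simp

theorem IsSDMetric.exists_path (hd : IsSDMetric d) (u : V) : ∀ (m : ℕ) (v : V), d u v ≤ m →
    ∃ p : ℕ → V, p 0 = u ∧ p m = v ∧ ∀ t < m, d (p t) (p (t + 1)) ≤ 1 := by
  intro m
  induction m with
  | zero =>
    intro v huv
    exact ⟨fun _ => u, rfl, hd.self_iff.1 (Nat.le_zero.1 huv), fun t ht => absurd ht (by omega)⟩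
  | succ m ih =>
    intro v huv
    obtain ⟨y, h1, h2⟩ : ∃ y, d u y ≤ m ∧ d v y ≤ 1 := by
      rcases huv.lt_or_eq with h1 | h1
      · exact ⟨v, by omega, by simp [hd.self_eq]⟩
      · obtain ⟨y, h2, h3⟩ := hd.exists_step h1
        exact ⟨y, h2.le, h3⟩
    obtain ⟨p, h3, h4, h5⟩ := ih y h1
    refine ⟨fun t => if t ≤ m then p t else v, by simpa using h3, by simp, fun t ht => ?_⟩
    beta_reduce
    rcases Nat.lt_succ_iff_lt_or_eq.1 ht with ht | rfl
    · rw [if_pos (by omega), if_pos (by omega)]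
      exact h5 t ht
    · rw [if_pos le_rfl, if_neg (by omega), h4, hd.symm]
      exact h2

theorem IsSDMetric.dist_le_of_path (hd : IsSDMetric d) {p : ℕ → V} (l : ℕ)
    (hp : ∀ t < l, d (p t) (p (t + 1)) ≤ 1) : d (p 0) (p l) ≤ l := by
  induction l with
  | zero => rw [hd.self_eq]
  | succ l ih =>
    have h1 := ih fun t ht => hp t (by omega)
    have h2 := hp l (by omega)
    have h3 := hd.tri (p 0) (p l) (p (l + 1))
    omega

theorem IsSDMetric.finite_ball (hd : IsSDMetric d) (hfin : ∀ v, {x | d v x ≤ 1}.Finite) (v : V)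
    (r : ℕ) : {x | d v x ≤ r}.Finite := by
  induction r with
  | zero =>
    refine (Set.finite_singleton v).subset fun x hx => ?_
    exact (hd.self_iff.1 (Nat.le_zero.1 hx)).symm
  | succ r ih =>
    refine (ih.biUnion fun y _ => hfin y).subset fun x hx => ?_
    rcases Nat.lt_or_ge (d v x) (r + 1) with h1 | h1
    · exact Set.mem_biUnion (x := x) (show d v x ≤ r by omega)
        (show d x x ≤ 1 by simp [hd.self_eq])
    · obtain ⟨y, h2, h3⟩ := hd.exists_step (le_antisymm hx h1)
      rw [hd.symm] at h3
      exact Set.mem_biUnion (x := y) (show d v y ≤ r from h2.le) h3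

/-- A point which is moved by `h ^ n` by at most `m` gives rise to an equivariant sequence. -/
theorem IsSDMetric.exists_sequence_of_dist_le (hd : IsSDMetric d)
    (hh : ∀ u v, d (h u) (h v) = d u v) (hfin : ∀ v, {x | d v x ≤ 1}.Finite)
    {n m : ℕ} (hn : 1 ≤ n) (hm : 1 ≤ m) {y : V}
    (hy : d y ((h ^ n) y) ≤ m) :
    ∃ f : ℤ → V, (∀ a, f (a + m) = h (f a)) ∧ ∀ a b : ℤ, |a - b| ≤ n → d (f a) (f b) ≤ 1 := by
  classical
  obtain ⟨p, hp0, hpm, hp⟩ := hd.exists_path y m _ hy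
  have hm0 : (m : ℤ) ≠ 0 := by omega
  have hn0 : (n : ℤ) ≠ 0 := by omega
  let γ : ℤ → V := fun t => (h ^ (n * (t / m))) (p (t % m).toNat)
  have hγq : ∀ t q : ℤ, γ (t + q * m) = (h ^ (n * q)) (γ t) := by
    intro t q
    simp only [γ]
    rw [Int.add_mul_ediv_right _ _ hm0, Int.add_mul_emod_self_right, mul_add, add_comm, zpow_add,
      Equiv.Perm.mul_apply]
  have hγ1 : ∀ t, d (γ t) (γ (t + 1)) ≤ 1 := by
    intro t
    have e := Int.mul_ediv_add_emod t m
    have h1 := Int.emod_nonneg t hm0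
    have h2 := Int.emod_lt_of_pos t (show (0 : ℤ) < m by omega)
    obtain ⟨r, hr⟩ := Int.eq_ofNat_of_zero_le h1
    have h3 : γ t = (h ^ (n * (t / m))) (p r) := by
      simp only [γ]
      rw [hr]
      simp
    have h4 : γ (t + 1) = (h ^ (n * (t / m))) (p (r + 1)) := by
      have e1 : t + 1 = (r + 1 : ℕ) + t / m * m := by
        push_cast
        rw [mul_comm]
        omega
      rw [e1, hγq]
      congr 1
      have hrm : r < m := by omega
      rcases Nat.lt_or_ge (r + 1) m with h5 | h5
      · simp only [γ]
        rw [Int.ediv_eq_zero_of_lt (by omega) (by omega), Int.emod_eq_of_lt (by omega) (by omega)]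
        simp
      · have e2 : r + 1 = m := by omega
        simp only [γ]
        rw [e2, Int.ediv_self hm0, Int.emod_self, hpm]
        simp [hp0]
    rw [h3, h4, dist_zpow hh]
    exact hp r (by omega)
  let A : ℤ → Set V := fun a => {u | ∃ i : ℤ, u = (h ^ i) (γ ((a - i * m) / n))}
  have hAshift : ∀ (a k : ℤ) u, u ∈ A a → (h ^ k) u ∈ A (a + k * m) := by
    rintro a k _ ⟨i, rfl⟩
    refine ⟨k + i, ?_⟩
    rw [zpow_add, Equiv.Perm.mul_apply]
    congr 4
    ring
  have hAfin : ∀ a, (A a).Finite := by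
    intro a
    refine ((Set.finite_Ico (0 : ℤ) n).image fun r => (h ^ r) (γ ((a - r * m) / n))).subset ?_
    rintro _ ⟨i, rfl⟩
    refine ⟨i % n, ⟨Int.emod_nonneg _ hn0, Int.emod_lt_of_pos _ (by omega)⟩, ?_⟩
    have e := Int.mul_ediv_add_emod i n
    have e1 : (a - i * m) / n = (a - i % n * m) / n + -(i / n) * m := by
      rw [← Int.add_mul_ediv_right _ _ hn0]
      congr 1
      calc a - i * m = a - (n * (i / n) + i % n) * m := by rw [e]
        _ = _ := by ring
    have e2 : (h ^ i) = h ^ (i % n) * h ^ (n * (i / n)) := by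
      rw [← zpow_add, add_comm, e]
    rw [e1, hγq, e2, Equiv.Perm.mul_apply, ← Equiv.Perm.mul_apply (h ^ ((n : ℤ) * (i / n))),
      ← zpow_add]
    simp
  obtain ⟨R, hR⟩ := (((Set.finite_Ico (0 : ℤ) m).biUnion fun a _ => hAfin a).image
    (d y)).bddAbove
  obtain ⟨f, h1, -, h2⟩ := hd.exists_equivariant_sequence hh hn hm
    (D := fun a => {x | d ((h ^ (a / m)) y) x ≤ R}) (A := A)
    (fun a => hd.finite_ball hfin _ _) (fun a => hd.metricConvex_ball _ _)
    (fun a u => by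
      have e : (h ^ ((a + m) / m)) y = h ((h ^ (a / m)) y) := by
        rw [Int.add_ediv_of_dvd_right (dvd_refl _), Int.ediv_self hm0, add_comm, zpow_add,
          zpow_one, Equiv.Perm.mul_apply]
      change d _ _ ≤ R ↔ d _ _ ≤ R
      rw [e, hh])
    (fun a u hu => by
      have e := Int.mul_ediv_add_emod a m
      have h1 := hAshift a (-(a / m)) u hu
      have e2 : a + -(a / m) * m = a % m := by
        rw [neg_mul, mul_comm]
        omega
      rw [e2] at h1
      have h2 := hR (Set.mem_image_of_mem (d y) (Set.mem_biUnion (x := a % m)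
        ⟨Int.emod_nonneg _ hm0, Int.emod_lt_of_pos _ (by omega)⟩ h1))
      rw [← dist_zpow hh (a / m), ← Equiv.Perm.mul_apply (h ^ (a / m)) (h ^ (-(a / m))),
        ← zpow_add] at h2
      simpa using h2)
    (fun a => ⟨_, 0, rfl⟩)
    (by
      rintro a j hj _ ⟨i, rfl⟩
      refine ⟨_, ⟨i, rfl⟩, ?_⟩
      rw [dist_zpow hh]
      have e1 : a + 1 + (j : ℤ) - i * m = (a - i * m) + (1 + j) := by ring
      have h3 : (a - i * m) / n ≤ (a + 1 + j - i * m) / n :=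
        Int.ediv_le_ediv (by omega) (by omega)
      have h4 : (a + 1 + j - i * m) / n ≤ (a - i * m) / n + 1 := by
        have h5 : (a - i * m + n) / n = (a - i * m) / n + 1 := by
          rw [Int.add_ediv_of_dvd_right (dvd_refl _), Int.ediv_self hn0]
        rw [← h5]
        exact Int.ediv_le_ediv (by omega) (by omega)
      rcases h3.lt_or_eq with h5 | h5
      · have e2 : (a + 1 + j - i * m) / n = (a - i * m) / n + 1 := by omega
        rw [e2]
        exact hγ1 _
      · rw [← h5, hd.self_eq]
        exact zero_le_one)
  exact ⟨f, h1, h2⟩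

/-- An isometry with a periodic point leaves invariant a finite clique. -/
theorem IsSDMetric.exists_invariant_clique (hd : IsSDMetric d)
    (hh : ∀ u v, d (h u) (h v) = d u v) (hfin : ∀ v, {x | d v x ≤ 1}.Finite)
    {i : ℕ} (hi : 1 ≤ i) {y : V} (hy : (h ^ i) y = y) :
    ∃ σ : Finset V, σ.Nonempty ∧ (∀ u ∈ σ, ∀ v ∈ σ, d u v ≤ 1) ∧ σ.map h.toEmbedding = σ := by
  classical
  have hyz : ∀ k : ℕ, (h ^ (i * k)) y = y := by
    intro k
    rw [pow_mul]
    induction k with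
    | zero => rfl
    | succ k ih => rw [pow_succ, Equiv.Perm.mul_apply, hy, ih]
  have hO : (Set.range fun k : ℤ => (h ^ k) y).Finite := by
    refine ((Set.finite_Ico (0 : ℤ) i).image fun r => (h ^ r) y).subset ?_
    rintro _ ⟨k, rfl⟩
    refine ⟨k % i, ⟨Int.emod_nonneg _ (by omega), Int.emod_lt_of_pos _ (by omega)⟩, ?_⟩
    have e : (h ^ k) = h ^ (k % i) * (h ^ (i : ℤ)) ^ (k / i) := by
      rw [← zpow_mul, ← zpow_add, add_comm, Int.mul_ediv_add_emod]
    have e2 : ((h ^ (i : ℤ)) ^ (k / i)) y = y :=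
      Equiv.Perm.zpow_apply_eq_self_of_apply_eq_self (by rw [zpow_natCast]; exact hy) _
    change (h ^ (k % i)) y = (h ^ k) y
    rw [e, Equiv.Perm.mul_apply, e2]
  obtain ⟨R, hR⟩ := (hO.image (d y)).bddAbove
  have hB := hd.finite_ball hfin y R
  obtain ⟨f, h1, h2, h3⟩ := hd.exists_equivariant_sequence hh (n := i * (hB.toFinset.card + 1))
    (m := 1) (Nat.mul_pos hi (Nat.succ_pos _)) le_rfl (D := fun a => {x | d ((h ^ a) y) x ≤ R})
    (A := fun _ => Set.range fun k : ℤ => (h ^ k) y)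
    (fun a => hd.finite_ball hfin _ _) (fun a => hd.metricConvex_ball _ _)
    (fun a u => by
      change d _ _ ≤ R ↔ d _ _ ≤ R
      rw [Nat.cast_one, add_comm, zpow_add, zpow_one, Equiv.Perm.mul_apply, hh])
    (by
      rintro a _ ⟨k, rfl⟩
      change d _ _ ≤ R
      rw [← dist_zpow hh (-a), ← Equiv.Perm.mul_apply, ← Equiv.Perm.mul_apply, ← zpow_add,
        ← zpow_add, neg_add_cancel, zpow_zero]
      exact hR (Set.mem_image_of_mem _ ⟨_, rfl⟩))
    (fun a => ⟨_, 0, rfl⟩)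
    (fun a j _ u hu => ⟨u, hu, by simp [hd.self_eq]⟩)
  have hf : ∀ k : ℕ, f k = (h ^ k) (f 0) := by
    intro k
    induction k with
    | zero => simp
    | succ k ih =>
      rw [pow_succ', Equiv.Perm.mul_apply, ← ih, ← h1]
      simp
  obtain ⟨s, hs, t, ht, hst, hfst⟩ := Finset.exists_ne_map_eq_of_card_lt_of_maps_to
    (s := Finset.range (hB.toFinset.card + 1)) (t := hB.toFinset)
    (f := fun k => (h ^ (i * k)) (f 0)) (by simp) (by
      intro k _
      beta_reduce
      rw [Finset.mem_coe, Set.Finite.mem_toFinset, ← hf]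
      have := h2 (i * k : ℕ)
      rw [Set.mem_ofPred_eq, zpow_natCast, hyz] at this
      exact this)
  obtain ⟨e, he0, hen, he⟩ : ∃ e : ℕ, 1 ≤ e ∧ e ≤ i * (hB.toFinset.card + 1) ∧
      (h ^ e) (f 0) = f 0 := by
    rw [Finset.mem_range] at hs ht
    have key : ∀ s t : ℕ, s < t → t < hB.toFinset.card + 1 →
        (h ^ (i * s)) (f 0) = (h ^ (i * t)) (f 0) → ∃ e : ℕ, 1 ≤ e ∧
        e ≤ i * (hB.toFinset.card + 1) ∧ (h ^ e) (f 0) = f 0 := by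
      intro s t hst ht h4
      refine ⟨i * (t - s), Nat.mul_pos hi (by omega), Nat.mul_le_mul_left _ (by omega), ?_⟩
      apply (h ^ (i * s)).injective
      rw [h4, ← Equiv.Perm.mul_apply, ← pow_add, ← mul_add, Nat.add_sub_cancel' hst.le]
    rcases Nat.lt_or_gt_of_ne hst with h4 | h4
    · exact key s t h4 ht hfst
    · exact key t s h4 hs hfst.symm
  refine ⟨(Finset.range e).image fun k => (h ^ k) (f 0), ?_, fun u hu v hv => ?_, ?_⟩
  · exact ⟨f 0, Finset.mem_image.2 ⟨0, Finset.mem_range.2 he0, rfl⟩⟩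
  · obtain ⟨s, hs, rfl⟩ := Finset.mem_image.1 hu
    obtain ⟨t, ht, rfl⟩ := Finset.mem_image.1 hv
    rw [Finset.mem_range] at hs ht
    rw [← hf, ← hf]
    refine h3 _ _ ?_
    rw [abs_le]
    omega
  · refine Finset.eq_of_subset_of_card_le (fun u hu => ?_) (by rw [Finset.card_map])
    obtain ⟨u, hu', rfl⟩ := Finset.mem_map.1 hu
    obtain ⟨s, hs, rfl⟩ := Finset.mem_image.1 hu'
    rw [Finset.mem_range] at hs
    change h _ ∈ _
    rw [← Equiv.Perm.mul_apply, ← pow_succ']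
    rcases Nat.lt_or_ge (s + 1) e with h4 | h4
    · exact Finset.mem_image.2 ⟨s + 1, Finset.mem_range.2 h4, rfl⟩
    · have : s + 1 = e := by omega
      rw [this, he]
      exact Finset.mem_image.2 ⟨0, Finset.mem_range.2 he0, rfl⟩

end Isometries

section Isometries

variable {V : Type*} {d : V → V → ℕ} {h : Equiv.Perm V}

theorem apply_add_mul_of_equivariant {f : ℤ → V} {m : ℤ} (hf : ∀ a, f (a + m) = h (f a))
    (a k : ℤ) : f (a + k * m) = (h ^ k) (f a) := by
  induction k with
  | zero => simp
  | succ k ih =>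
    rw [add_comm (k : ℤ), zpow_add, zpow_one, Equiv.Perm.mul_apply, ← ih, ← hf]
    congr 1
    ring
  | pred k ih =>
    rw [sub_eq_neg_add, zpow_add, Equiv.Perm.mul_apply, ← ih, zpow_neg_one,
      Equiv.Perm.eq_inv_iff_eq, ← hf]
    congr 1
    ring

theorem IsSDMetric.dist_apply_add_mul_le (hd : IsSDMetric d) {f : ℤ → V} {n : ℕ}
    (hf : ∀ a b : ℤ, |a - b| ≤ n → d (f a) (f b) ≤ 1) (a : ℤ) (k : ℕ) :
    d (f a) (f (a + k * n)) ≤ k := by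
  have := hd.dist_le_of_path (p := fun t => f (a + t * n)) k fun t _ => hf _ _ (by
    rw [show a + (t : ℤ) * n - (a + ((t + 1 : ℕ) : ℤ) * n) = -n by push_cast; ring, abs_neg,
      Nat.abs_cast])
  simpa using this

theorem pow_apply_injective (hnp : ∀ y, ∀ i : ℕ, 1 ≤ i → (h ^ i) y ≠ y) (u : V) :
    Function.Injective fun k : ℕ => (h ^ k) u := by
  have key : ∀ s t : ℕ, s < t → (h ^ s) u ≠ (h ^ t) u := by
    intro s t hst e
    refine hnp u (t - s) (by omega) ((h ^ s).injective ?_)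
    rw [e, ← Equiv.Perm.mul_apply, ← pow_add, Nat.add_sub_cancel' hst.le]
  intro s t e
  rcases Nat.lt_trichotomy s t with h1 | h1 | h1
  · exact absurd e (key s t h1)
  · exact h1
  · exact absurd e.symm (key t s h1)

/-- A closed walk modulo the action of `h`, in a set consisting of at most `K` orbits, moves with
at most the maximal speed that is attained by walks of length at most `K`. -/
theorem IsSDMetric.speed_le (hd : IsSDMetric d) (hh : ∀ u v, d (h u) (h v) = d u v)
    (hnp : ∀ y, ∀ i : ℕ, 1 ≤ i → (h ^ i) y ≠ y) {p q K : ℕ}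
    (hmin : ∀ j i x, 1 ≤ j → j ≤ K → 1 ≤ i → d x ((h ^ i) x) ≤ j → p * i ≤ q * j)
    (S : Finset V) (hS : S.card ≤ K) (l : ℕ) : ∀ (y : ℕ → V) (w : ℤ),
      (∀ t < l, d (y t) (y (t + 1)) ≤ 1) → (∀ t ≤ l, ∃ s ∈ S, ∃ k : ℤ, y t = (h ^ k) s) →
      y l = (h ^ w) (y 0) → (p : ℤ) * w ≤ q * l := by
  induction l using Nat.strong_induction_on with
  | _ l ih =>
  intro y w hy hyS hw
  rcases le_or_gt w 0 with hw0 | hw0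
  · exact (mul_nonpos_of_nonneg_of_nonpos (by omega) hw0).trans (by positivity)
  obtain ⟨i, rfl⟩ := Int.eq_ofNat_of_zero_le hw0.le
  have hi : 1 ≤ i := by omega
  rcases Nat.lt_or_ge K l with hl | hl
  · have hex : ∀ t : ℕ, ∃ s, t ≤ l → s ∈ S ∧ ∃ k : ℤ, y t = (h ^ k) s := by
      intro t
      by_cases ht : t ≤ l
      · obtain ⟨s, h1, h2⟩ := hyS t ht
        exact ⟨s, fun _ => ⟨h1, h2⟩⟩
      · exact ⟨y 0, fun h => absurd h ht⟩
    choose r hr using hex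
    obtain ⟨s, hs, t, ht, hst, hrst⟩ := Finset.exists_ne_map_eq_of_card_lt_of_maps_to
      (s := Finset.range (K + 1)) (t := S) (f := r) (by simp; omega) (by
        intro k hk
        have := Finset.mem_range.1 hk
        exact (hr k (by omega)).1)
    rw [Finset.mem_range] at hs ht
    obtain ⟨s, t, v, hst, htK, hv⟩ : ∃ (s t : ℕ) (v : ℤ), s < t ∧ t ≤ K ∧ y t = (h ^ v) (y s) := by
      obtain ⟨-, a, ha⟩ := hr s (by omega)
      obtain ⟨-, b, hb⟩ := hr t (by omega)
      rw [hrst] at ha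
      rcases Nat.lt_or_gt_of_ne hst with h1 | h1
      · refine ⟨s, t, b - a, h1, by omega, ?_⟩
        rw [ha, hb, ← Equiv.Perm.mul_apply, ← zpow_add, sub_add_cancel]
      · refine ⟨t, s, a - b, h1, by omega, ?_⟩
        rw [ha, hb, ← Equiv.Perm.mul_apply, ← zpow_add, sub_add_cancel]
    have h1 := ih (t - s) (by omega) (fun a => y (s + a)) v (fun a _ => hy (s + a) (by omega))
      (fun a _ => hyS (s + a) (by omega)) (by
        simp only [add_zero]
        rw [Nat.add_sub_cancel' hst.le, hv])
    have h2 := ih (l - (t - s)) (by omega)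
      (fun a => if a ≤ s then y a else (h ^ (-v)) (y (a + (t - s)))) (i - v)
      (by
        intro a ha
        rcases Nat.lt_trichotomy a s with h3 | h3 | h3
        · rw [if_pos h3.le, if_pos (by omega)]
          exact hy a (by omega)
        · subst h3
          rw [if_pos le_rfl, if_neg (by omega), ← dist_zpow hh v, ← hv,
            ← Equiv.Perm.mul_apply (h ^ v), ← zpow_add, add_neg_cancel, zpow_zero,
            Equiv.Perm.one_apply, show a + 1 + (t - a) = t + 1 by omega]
          exact hy t (by omega)
        · rw [if_neg (by omega), if_neg (by omega), dist_zpow hh,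
            show a + 1 + (t - s) = a + (t - s) + 1 by omega]
          exact hy _ (by omega))
      (by
        intro a ha
        by_cases h3 : a ≤ s
        · rw [if_pos h3]
          exact hyS a (by omega)
        · rw [if_neg h3]
          obtain ⟨u, hu, k, hk⟩ := hyS (a + (t - s)) (by omega)
          refine ⟨u, hu, -v + k, ?_⟩
          rw [hk, zpow_add, Equiv.Perm.mul_apply])
      (by
        rw [if_neg (by omega), if_pos (Nat.zero_le s), show l - (t - s) + (t - s) = l by omega,
          hw, sub_eq_neg_add, zpow_add, Equiv.Perm.mul_apply])
    have e1 : ((t - s : ℕ) : ℤ) = t - s := by omega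
    have e2 : ((l - (t - s) : ℕ) : ℤ) = l - (t - s) := by omega
    rw [e1] at h1
    rw [e2] at h2
    linarith
  · have hl1 : 1 ≤ l := by
      by_contra h0
      have : l = 0 := by omega
      subst this
      exact hnp (y 0) i hi (by rw [← zpow_natCast]; exact hw.symm)
    have h1 := hd.dist_le_of_path l hy
    rw [hw, zpow_natCast] at h1
    exact_mod_cast hmin l i (y 0) hl1 hl hi h1

variable {N : ℕ}

theorem IsSDMetric.lt_of_dist_le (hd : IsSDMetric d) (hh : ∀ u v, d (h u) (h v) = d u v)
    (hfin : ∀ v, {x | d v x ≤ 1}.Finite)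
    (hN : ∀ (S : Finset V), ∀ v ∈ S, (∀ x ∈ S, d v x ≤ 1) → S.card ≤ N + 1)
    (hnp : ∀ y, ∀ i : ℕ, 1 ≤ i → (h ^ i) y ≠ y) {i j : ℕ} (hi : 1 ≤ i) (hj : 1 ≤ j) {x : V}
    (hx : d x ((h ^ i) x) ≤ j) : i < j * (N + 1) := by
  classical
  obtain ⟨f, hf, hf1⟩ := hd.exists_sequence_of_dist_le hh hfin hi hj hx
  by_contra! hle
  have hfk : ∀ k : ℕ, f (k * j) = (h ^ k) (f 0) := fun k => by
    have := apply_add_mul_of_equivariant hf 0 k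
    rwa [zero_add, zpow_natCast] at this
  have := hN ((Finset.range (N + 2)).image fun k => (h ^ k) (f 0)) (f 0)
    (Finset.mem_image.2 ⟨0, by simp, rfl⟩) (fun x hx => by
      obtain ⟨k, hk, rfl⟩ := Finset.mem_image.1 hx
      rw [← hfk]
      refine hf1 _ _ ?_
      rw [zero_sub, abs_neg, abs_of_nonneg (by positivity)]
      have h1 : k ≤ N + 1 := by
        have := Finset.mem_range.1 hk
        omega
      calc (k : ℤ) * j = ((j * k : ℕ) : ℤ) := by push_cast; ring
        _ ≤ ((j * (N + 1) : ℕ) : ℤ) := by exact_mod_cast Nat.mul_le_mul_left j h1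
        _ ≤ i := by exact_mod_cast hle)
  rw [Finset.card_image_of_injective _ (pow_apply_injective hnp _), Finset.card_range] at this
  omega

theorem IsSDMetric.dist_pow_le (hd : IsSDMetric d) (hh : ∀ u v, d (h u) (h v) = d u v) (x : V)
    (i : ℕ) : d x ((h ^ i) x) ≤ d x (h x) * i := by
  induction i with
  | zero => simp [hd.self_eq]
  | succ i ih =>
    have h1 := hd.tri x ((h ^ i) x) ((h ^ (i + 1)) x)
    have h2 : d ((h ^ i) x) ((h ^ (i + 1)) x) = d x (h x) := by
      rw [pow_succ, Equiv.Perm.mul_apply, ← zpow_natCast, dist_zpow hh]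
    rw [mul_add, mul_one]
    omega

/-- The maximal speed of an isometry without periodic points is attained. -/
theorem IsSDMetric.exists_maximal_speed (hd : IsSDMetric d) [Nonempty V]
    (hh : ∀ u v, d (h u) (h v) = d u v) (hfin : ∀ v, {x | d v x ≤ 1}.Finite)
    (hN : ∀ (S : Finset V), ∀ v ∈ S, (∀ x ∈ S, d v x ≤ 1) → S.card ≤ N + 1)
    (hnp : ∀ y, ∀ i : ℕ, 1 ≤ i → (h ^ i) y ≠ y) :
    ∃ p q : ℕ, 1 ≤ p ∧ 1 ≤ q ∧ (∃ x, d x ((h ^ q) x) ≤ p) ∧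
      ∀ x, ∀ i, 1 ≤ i → p * i ≤ q * d x ((h ^ i) x) := by
  classical
  have hpos : ∀ x, ∀ i, 1 ≤ i → 1 ≤ d x ((h ^ i) x) := fun x i hi => by
    by_contra h0
    exact hnp x i hi (hd.self_iff.1 (by omega)).symm
  obtain ⟨x₀⟩ := ‹Nonempty V›
  set D₁ := d x₀ (h x₀) with hD₁
  have hD₁pos : 1 ≤ D₁ := by simpa using hpos x₀ 1 le_rfl
  set K := D₁ * (N + 1) with hK
  let Λ : Set (ℕ × ℕ) := {z | 1 ≤ z.1 ∧ z.1 ≤ K ∧ 1 ≤ z.2 ∧ ∃ x, d x ((h ^ z.2) x) ≤ z.1}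
  have hΛ : Λ.Finite := by
    refine ((Set.finite_Iic K).prod (Set.finite_Iic (K * (N + 1)))).subset ?_
    rintro ⟨j, i⟩ ⟨h1, h2, h3, x, hx⟩
    refine ⟨h2, ?_⟩
    have h4 := hd.lt_of_dist_le hh hfin hN hnp h3 h1 hx
    have h5 := Nat.mul_le_mul_right (N + 1) h2
    change i ≤ K * (N + 1)
    simp only at h4 h5
    omega
  obtain ⟨⟨p, q⟩, ⟨hp, hpK, hq, x, hx⟩, hmin⟩ := Set.exists_min_image Λ
    (fun z => (z.1 : ℚ) / z.2) hΛ ⟨(D₁, 1), hD₁pos, Nat.le_mul_of_pos_right _ (Nat.succ_pos N),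
      le_rfl, x₀, by simp [hD₁]⟩
  have hmin' : ∀ j i x, 1 ≤ j → j ≤ K → 1 ≤ i → d x ((h ^ i) x) ≤ j → p * i ≤ q * j := by
    intro j i x hj hjK hi hx
    have := hmin (j, i) ⟨hj, hjK, hi, x, hx⟩
    simp only at this hq
    rw [div_le_div_iff₀ (by exact_mod_cast hq) (by exact_mod_cast hi)] at this
    rw [mul_comm q]
    exact_mod_cast this
  refine ⟨p, q, hp, hq, ⟨x, hx⟩, fun x i hi => ?_⟩
  have hex : ∃ j, ∃ x, d x ((h ^ i) x) = j := ⟨_, x, rfl⟩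
  obtain ⟨z, hz⟩ := Nat.find_spec hex
  have hjle : ∀ x, Nat.find hex ≤ d x ((h ^ i) x) := fun x => Nat.find_min' hex ⟨x, rfl⟩
  generalize Nat.find hex = j at hz hjle
  have hj : 1 ≤ j := hz ▸ hpos z i hi
  have hj0 : (j : ℤ) ≠ 0 := by omega
  obtain ⟨f, hf, hf1⟩ := hd.exists_sequence_of_dist_le hh hfin hi hj hz.le
  have hjD : j ≤ D₁ * i := (hjle x₀).trans (hd.dist_pow_le hh x₀ i)
  have hcard : ((Finset.range j).image fun a : ℕ => f a).card ≤ K := by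
    refine le_trans (Finset.card_le_card (t := (Finset.range D₁).biUnion fun s : ℕ =>
      (Finset.range i).image fun r : ℕ => f ((s * i + r : ℕ) : ℤ)) ?_) ?_
    · intro u hu
      obtain ⟨a, ha, rfl⟩ := Finset.mem_image.1 hu
      have ha' := Finset.mem_range.1 ha
      refine Finset.mem_biUnion.2 ⟨a / i, Finset.mem_range.2 ?_, Finset.mem_image.2
        ⟨a % i, Finset.mem_range.2 (Nat.mod_lt _ hi), ?_⟩⟩
      · rw [Nat.div_lt_iff_lt_mul hi]
        omega
      · rw [Nat.div_add_mod']
    · refine (Finset.card_biUnion_le_card_mul _ _ (N + 1) fun s _ => ?_).trans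
        (by rw [Finset.card_range])
      refine hN _ (f ((s * i + 0 : ℕ) : ℤ))
        (Finset.mem_image.2 ⟨0, Finset.mem_range.2 hi, rfl⟩) fun u hu => ?_
      obtain ⟨r, hr, rfl⟩ := Finset.mem_image.1 hu
      have hr' := Finset.mem_range.1 hr
      refine hf1 _ _ ?_
      rw [abs_le]
      constructor <;> push_cast <;> omega
  have key := hd.speed_le hh hnp hmin' _ hcard j (fun t => f (t * i)) i
    (fun t _ => hf1 _ _ (by
      rw [show (t : ℤ) * i - ((t + 1 : ℕ) : ℤ) * i = -i by push_cast; ring, abs_neg, Nat.abs_cast]))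
    (fun t _ => by
      refine ⟨f (((t * i : ℕ) % j : ℕ) : ℤ), Finset.mem_image.2
        ⟨_, Finset.mem_range.2 (Nat.mod_lt _ hj), rfl⟩, ((t * i / j : ℕ) : ℤ), ?_⟩
      rw [← apply_add_mul_of_equivariant hf]
      congr 1
      exact_mod_cast (Nat.mod_add_div' (t * i) j).symm)
    (by
      have := apply_add_mul_of_equivariant hf 0 i
      rw [zero_add] at this
      simp only [Nat.cast_zero, zero_mul]
      rw [← this, mul_comm])
  have key' : p * i ≤ q * j := by exact_mod_cast key
  exact key'.trans (Nat.mul_le_mul_left q (hjle x))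

/-- An isometry without periodic points has an invariant thick geodesic. -/
theorem IsSDMetric.exists_thick_axis (hd : IsSDMetric d) [Nonempty V]
    (hh : ∀ u v, d (h u) (h v) = d u v) (hfin : ∀ v, {x | d v x ≤ 1}.Finite)
    (hN : ∀ (S : Finset V), ∀ v ∈ S, (∀ x ∈ S, d v x ≤ 1) → S.card ≤ N + 1)
    (hnp : ∀ y, ∀ i : ℕ, 1 ≤ i → (h ^ i) y ≠ y) :
    ∃ (p q : ℕ) (f : ℤ → V), 1 ≤ q ∧ (∀ a, f (a + p) = h (f a)) ∧
      (∀ a b : ℤ, |a - b| ≤ q → d (f a) (f b) ≤ 1) ∧ ∀ a b : ℤ, |a - b| ≤ q * d (f a) (f b) := by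
  obtain ⟨P, Q, hP, hQ, ⟨x, hx⟩, hspeed⟩ := hd.exists_maximal_speed hh hfin hN hnp
  obtain ⟨g, p, q, hg, hpq, rfl, rfl⟩ := Nat.exists_coprime' (m := P) (n := Q)
    (Nat.gcd_pos_of_pos_left _ hP)
  have hp : 1 ≤ p := Nat.pos_of_mul_pos_right hP
  have hq : 1 ≤ q := Nat.pos_of_mul_pos_right hQ
  have hspeed' : ∀ x, ∀ i, 1 ≤ i → p * i ≤ q * d x ((h ^ i) x) := fun x i hi => by
    have := hspeed x i hi
    refine Nat.le_of_mul_le_mul_left (c := g) ?_ hg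
    nlinarith
  obtain ⟨F, hF, hF1⟩ := hd.exists_sequence_of_dist_le hh hfin hQ hP hx
  have hFx : d (F 0) ((h ^ q) (F 0)) ≤ p := by
    have h1 := hd.dist_apply_add_mul_le hF1 0 p
    have h2 := apply_add_mul_of_equivariant hF 0 q
    rw [zpow_natCast] at h2
    rw [← h2]
    convert h1 using 3
    push_cast
    ring
  obtain ⟨f, hf, hf1⟩ := hd.exists_sequence_of_dist_le hh hfin hq hp hFx
  have key : ∀ a b : ℤ, a < b → b - a ≤ q * d (f a) (f b) := by
    intro a b hab
    obtain ⟨i, t, ht, hit⟩ : ∃ i t : ℕ, 1 ≤ t ∧ b - a + i * q = t * p := by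
      have hbez := Nat.gcd_eq_gcd_ab p q
      rw [hpq] at hbez
      set u := Nat.gcdA p q
      set v := Nat.gcdB p q
      have hi : 0 ≤ -((b - a) * v) + p * |(b - a) * v| := by
        have h1 := neg_abs_le ((b - a) * v)
        have h2 := le_abs_self ((b - a) * v)
        have h3 : 1 * |(b - a) * v| ≤ p * |(b - a) * v| :=
          mul_le_mul_of_nonneg_right (by omega) (abs_nonneg _)
        omega
      obtain ⟨i, hi'⟩ := Int.eq_ofNat_of_zero_le hi
      have e : b - a + i * q = ((b - a) * u + q * |(b - a) * v|) * p := by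
        have : b - a = (b - a) * (p * u + q * v) := by rw [← hbez]; simp
        rw [← hi']
        linear_combination this
      have ht : 0 < (b - a) * u + q * |(b - a) * v| := by
        refine pos_of_mul_pos_left (b := (p : ℤ)) ?_ (by omega)
        rw [← e]
        have : 0 ≤ (i : ℤ) * q := by positivity
        omega
      obtain ⟨t, ht'⟩ := Int.eq_ofNat_of_zero_le ht.le
      exact ⟨i, t, by omega, by rw [e, ht']⟩
    have h1 := hspeed' (f a) t ht
    have h2 := apply_add_mul_of_equivariant hf a t
    rw [zpow_natCast] at h2
    rw [← h2] at h1
    have h3 := hd.dist_apply_add_mul_le hf1 b i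
    have e : b + i * q = a + t * p := by omega
    rw [e] at h3
    have h4 := hd.tri (f a) (f b) (f (a + t * p))
    have h5 : p * t ≤ q * (d (f a) (f b) + i) := h1.trans (Nat.mul_le_mul_left q (by omega))
    have h6 : (p : ℤ) * t ≤ q * (d (f a) (f b) + i) := by exact_mod_cast h5
    linarith
  refine ⟨p, q, f, hq, hf, hf1, fun a b => ?_⟩
  rcases lt_trichotomy a b with h1 | rfl | h1
  · rw [abs_sub_comm, abs_of_pos (by omega)]
    exact key a b h1
  · rw [sub_self, abs_zero]
    positivity
  · rw [hd.symm, abs_of_pos (by omega)]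
    exact key b a h1

end Isometries

namespace AbstractSimplicialComplex

variable {V : Type*} {X : AbstractSimplicialComplex V}

theorem vdist_comm (X : AbstractSimplicialComplex V) (u v : V) : X.vdist u v = X.vdist v u :=
  SimpleGraph.dist_comm

theorem IsWeaklySystolic.vdist_le_one_iff (hX : X.IsWeaklySystolic) {u v : V} :
    X.vdist u v ≤ 1 ↔ u = v ∨ X.skeletonGraph.Adj u v := by
  constructor
  · intro h
    rcases Nat.le_one_iff_eq_zero_or_eq_one.1 h with h | h
    · exact Or.inl ((hX.connected u v).dist_eq_zero_iff.1 h)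
    · exact Or.inr (SimpleGraph.dist_eq_one_iff_adj.1 h)
  · rintro (rfl | h)
    · simp [vdist]
    · exact (SimpleGraph.dist_eq_one_iff_adj.2 h).le

theorem IsWeaklySystolic.vdist_le_one_of_mem_faces (hX : X.IsWeaklySystolic) {σ : Finset V}
    (hσ : σ ∈ X.faces) {u v : V} (hu : u ∈ σ) (hv : v ∈ σ) : X.vdist u v ≤ 1 := by
  classical
  rw [hX.vdist_le_one_iff]
  by_cases huv : u = v
  · exact Or.inl huv
  · refine Or.inr ⟨huv, (X.isRelLowerSet_faces hσ).2 ?_ ⟨u, by simp⟩⟩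
    intro x hx
    simp only [Finset.mem_insert, Finset.mem_singleton] at hx
    rcases hx with rfl | rfl
    · exact hu
    · exact hv

theorem IsWeaklySystolic.mem_faces_iff (hX : X.IsWeaklySystolic) {σ : Finset V} :
    σ ∈ X.faces ↔ σ.Nonempty ∧ ∀ u ∈ σ, ∀ v ∈ σ, X.vdist u v ≤ 1 :=
  ⟨fun hσ => ⟨(X.isRelLowerSet_faces hσ).1, fun _ hu _ hv =>
    hX.vdist_le_one_of_mem_faces hσ hu hv⟩,
  fun ⟨h1, h2⟩ => hX.flag σ h1 fun u hu v hv huv =>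
    (hX.vdist_le_one_iff.1 (h2 u hu v hv)).resolve_left huv⟩

/-- The combinatorial metric of a weakly systolic complex. -/
theorem IsWeaklySystolic.isSDMetric (hX : X.IsWeaklySystolic) : IsSDMetric X.vdist where
  self_iff := fun {u v} => (hX.connected u v).dist_eq_zero_iff
  symm := fun _ _ => SimpleGraph.dist_comm
  tri := fun _ _ _ => hX.connected.dist_triangle
  exists_common := by
    classical
    intro v i σ hne h1 h2
    have hσ := hX.mem_faces_iff.2 ⟨hne, h2⟩
    obtain ⟨τ, hτ, e⟩ := hX.sd v i i le_rfl σ hσ h1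
    obtain ⟨y, hy⟩ := (X.isRelLowerSet_faces hτ).1
    have hy' : y ∈ (τ : Set V) := hy
    rw [e] at hy'
    obtain ⟨⟨-, -, h3⟩, h4⟩ := hy'
    refine ⟨y, h4, fun x hx => hX.vdist_le_one_of_mem_faces h3 (Finset.mem_union_right _ ?_)
      (Finset.mem_union_left _ (Finset.mem_singleton_self y))⟩
    exact hx
  descend_clique := by
    classical
    intro v i x y z hx hy hz hxy hxz
    obtain ⟨τ, hτ, e⟩ := hX.sd v i i le_rfl {x} (X.singleton_mem x) (by simpa using hx)
    have key : ∀ y, X.vdist v y ≤ i → X.vdist x y ≤ 1 → y ∈ τ := by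
      intro y hy hxy
      have hne : y ≠ x := by
        rintro rfl
        omega
      have : y ∈ (τ : Set V) := by
        rw [e]
        refine ⟨⟨X.singleton_mem y, by simpa using hne, ?_⟩, hy⟩
        refine hX.mem_faces_iff.2 ⟨⟨y, by simp⟩, fun a ha b hb => ?_⟩
        simp only [Finset.mem_union, Finset.mem_singleton] at ha hb
        rcases ha with rfl | rfl <;> rcases hb with rfl | rfl
        · simp [vdist]
        · rw [vdist, SimpleGraph.dist_comm]; exact hxy
        · exact hxy
        · simp [vdist]
      exact this
    exact hX.vdist_le_one_of_mem_faces hτ (key y hy hxy) (key z hz hxz)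

theorem thickLine_adj {k : ℕ} {a b : ℤ} :
    (thickLine k).skeletonGraph.Adj a b ↔ a ≠ b ∧ |a - b| ≤ k := by
  refine and_congr_right fun _ => ⟨fun h => h.2 a (by simp) b (by simp), fun h =>
    ⟨⟨a, by simp⟩, fun x hx y hy => ?_⟩⟩
  simp only [Finset.mem_insert, Finset.mem_singleton] at hx hy
  rw [abs_le] at h ⊢
  rcases hx with rfl | rfl <;> rcases hy with rfl | rfl <;> constructor <;> omega

theorem abs_sub_le_of_walk {k : ℕ} {a b : ℤ} (w : (thickLine k).skeletonGraph.Walk a b) :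
    |a - b| ≤ w.length * k := by
  induction w with
  | nil => simp
  | cons h w ih =>
    have h1 := (thickLine_adj.1 h).2
    rw [SimpleGraph.Walk.length_cons]
    push_cast
    rw [add_mul, one_mul]
    rw [abs_le] at *
    constructor <;> linarith [h1.1, h1.2, ih.1, ih.2]

theorem exists_thickLine_walk {k : ℕ} (hk : 1 ≤ k) (a : ℤ) (j : ℕ) :
    ∃ w : (thickLine k).skeletonGraph.Walk a (a + j * k), w.length = j := by
  induction j generalizing a with
  | zero => exact ⟨SimpleGraph.Walk.nil.copy rfl (by simp), by simp⟩
  | succ j ih =>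
    obtain ⟨w, hw⟩ := ih (a + k)
    have h : (thickLine k).skeletonGraph.Adj a (a + k) := thickLine_adj.2 ⟨by omega, by simp⟩
    exact ⟨(SimpleGraph.Walk.cons h w).copy rfl (by push_cast; ring), by simp [hw]⟩

theorem thickLine_vdist {k : ℕ} (hk : 1 ≤ k) (a : ℤ) (j : ℕ) :
    (thickLine k).vdist a (a + j * k) = j := by
  obtain ⟨w, hw⟩ := exists_thickLine_walk hk a j
  refine le_antisymm ((SimpleGraph.dist_le w).trans hw.le) ?_
  obtain ⟨w', hw'⟩ := SimpleGraph.Reachable.exists_walk_length_eq_dist ⟨w⟩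
  have h1 := abs_sub_le_of_walk w'
  rw [hw', sub_add_cancel_left, abs_neg, abs_of_nonneg (by positivity)] at h1
  have h2 : (j : ℤ) ≤ (thickLine k).skeletonGraph.dist a (a + j * k) :=
    le_of_mul_le_mul_right h1 (by omega)
  exact_mod_cast h2

theorem IsUniformlyLocallyFinite.exists_card_le (hfin : X.IsUniformlyLocallyFinite)
    (hX : X.IsWeaklySystolic) : (∀ v, {x | X.vdist v x ≤ 1}.Finite) ∧
      ∃ N : ℕ, ∀ (S : Finset V), ∀ v ∈ S, (∀ x ∈ S, X.vdist v x ≤ 1) → S.card ≤ N + 1 := by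
  classical
  obtain ⟨N, hN⟩ := hfin
  refine ⟨fun v => ?_, N, fun S v hv hS => ?_⟩
  · have h1 : (X.skeletonGraph.neighborSet v).Finite :=
      Set.finite_of_encard_le_coe (hN v)
    refine (h1.insert v).subset fun x hx => ?_
    rcases hX.vdist_le_one_iff.1 hx with rfl | h
    · exact Set.mem_insert _ _
    · exact Set.mem_insert_of_mem _ h
  · have h1 : ((S.erase v : Finset V) : Set V) ⊆ X.skeletonGraph.neighborSet v := by
      intro x hx
      obtain ⟨h2, h3⟩ := Finset.mem_erase.1 (Finset.mem_coe.1 hx)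
      exact (hX.vdist_le_one_iff.1 (hS x h3)).resolve_left fun e => h2 e.symm
    have h2 := (Set.encard_le_encard h1).trans (hN v)
    rw [Set.encard_coe_eq_coe_finsetCard, Finset.card_erase_of_mem hv] at h2
    have h3 : S.card - 1 ≤ N := by exact_mod_cast h2
    omega

/-- A sufficient condition for being a thick geodesic. -/
theorem IsWeaklySystolic.isThickGeodesic (hX : X.IsWeaklySystolic) {k : ℕ} (hk : 1 ≤ k)
    (f : ℤ ↪ V) (h1 : ∀ a b : ℤ, |a - b| ≤ k → X.vdist (f a) (f b) ≤ 1)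
    (h2 : ∀ a b : ℤ, |a - b| ≤ k * X.vdist (f a) (f b)) : X.IsThickGeodesic k f := by
  have hvd : ∀ (a : ℤ) (j : ℕ), X.vdist (f a) (f (a + j * k)) = j := by
    intro a j
    refine le_antisymm (hX.isSDMetric.dist_apply_add_mul_le h1 a j) ?_
    have h3 := h2 a (a + j * k)
    rw [sub_add_cancel_left, abs_neg, abs_of_nonneg (by positivity)] at h3
    exact Nat.cast_le.1
      (le_of_mul_le_mul_left ((mul_comm _ _).trans_le h3) (by omega : 0 < (k : ℤ)))
  refine ⟨hk, fun σ => ?_, fun a a' j haa => ?_⟩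
  · rw [hX.mem_faces_iff, Finset.map_nonempty]
    refine and_congr_right fun _ => ?_
    constructor
    · intro h a ha b hb
      have h3 := h _ (Finset.mem_map_of_mem f ha) _ (Finset.mem_map_of_mem f hb)
      have h4 : (k : ℤ) * X.vdist (f a) (f b) ≤ k * 1 :=
        mul_le_mul_of_nonneg_left (by exact_mod_cast h3) (by omega)
      linarith [h2 a b]
    · intro h u hu v hv
      obtain ⟨a, ha, rfl⟩ := Finset.mem_map.1 hu
      obtain ⟨b, hb, rfl⟩ := Finset.mem_map.1 hv
      exact h1 a b (h a ha b hb)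
  · obtain ⟨j, rfl | rfl⟩ := j.eq_nat_or_neg
    · obtain rfl : a = a' + j * k := by omega
      rw [vdist_comm, hvd, vdist_comm, thickLine_vdist hk]
    · obtain rfl : a' = a + j * k := by linarith
      rw [hvd, thickLine_vdist hk]

end AbstractSimplicialComplex

theorem corollary3p8 {V : Type*} (X : AbstractSimplicialComplex V)
    (hX : X.IsWeaklySystolic) (hfin : X.IsUniformlyLocallyFinite)
    (h : V ≃ V) (hh : X.IsSimplicialIsometry h) :
    (∃ σ ∈ X.faces, σ.map h.toEmbedding = σ) ∨
      (∃ (k : ℕ) (f : ℤ ↪ V), X.IsThickGeodesic k f ∧ h '' Set.range f = Set.range f) := by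
  have hd := hX.isSDMetric
  obtain ⟨hball, N, hN⟩ := hfin.exists_card_le hX
  have := hX.connected.nonempty
  by_cases hper : ∃ y, ∃ i : ℕ, 1 ≤ i ∧ (h ^ i : Equiv.Perm V) y = y
  · obtain ⟨y, i, hi, hy⟩ := hper
    obtain ⟨σ, h1, h2, h3⟩ := hd.exists_invariant_clique hh.vdist_map hball hi hy
    exact Or.inl ⟨σ, hX.mem_faces_iff.2 ⟨h1, h2⟩, h3⟩
  · push Not at hper
    obtain ⟨p, q, f, hq, h1, h2, h3⟩ := hd.exists_thick_axis hh.vdist_map hball hN hper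
    have hinj : Function.Injective f := fun a b hab => by
      have h4 := h3 a b
      rw [hab, hd.self_eq, Nat.cast_zero, mul_zero, abs_nonpos_iff] at h4
      omega
    refine Or.inr ⟨q, ⟨f, hinj⟩, hX.isThickGeodesic hq ⟨f, hinj⟩ h2 h3, ?_⟩
    ext x
    constructor
    · rintro ⟨_, ⟨a, rfl⟩, rfl⟩
      exact ⟨a + p, h1 a⟩
    · rintro ⟨a, rfl⟩
      exact ⟨f (a - p), ⟨a - p, rfl⟩, by rw [← h1, sub_add_cancel]; rfl⟩
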